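/- Let $\alpha>0$, $u_0>0$, $u_\pm\in\mathbb C$ with $|u_\pm|=u_0$, and let $u:\mathbb R\times\mathbb R\to\mathbb C$ (in the application, a solution of the modified NLS equation $iu_t+u_{xx}+4i\alpha u_x+\frac{i}{\alpha}(|u|^2u)_x=0$) be such that for every $t$ the function $u(\cdot,t)$ is differentiable, $u(x,t)\to u_\pm$ as $x\to\pm\infty$, $u(\cdot,t)-u_-\in L^1(-\infty,0)$, $u(\cdot,t)-u_+\in L^1(0,\infty)$ and $u_x(\cdot,t)\in L^1(\mathbb R)$. Put $$\sigma_3=\begin{pmatrix}1&0\\0&-1\end{pmatrix},\quad Q=\begin{pmatrix}0&u\\ \bar u&0\end{pmatrix},\quad Q_\pm=\begin{pmatrix}0&u_\pm\\ \bar u_\pm&0\end{pmatrix},\quad k=\frac{1}{2\alpha}\Big(z-\frac{u_0^2}{z}\Big),\quad \lambda=\frac12\Big(z+\frac{u_0^2}{z}\Big),$$ $$X=-i\alpha k^2\sigma_3+ikQ,\qquad Y_\pm=I+\frac1z\sigma_3Q_\pm,\qquad \theta=-k\lambda\Big[x+\Big(2\alpha k^2-4\alpha-\frac{u_0^2}{\alpha}\Big)t\Big].$$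 The Jost solutions $\phi_\pm(x,t,z)$ are the solutions of the spatial equation $\phi_x=X\phi$ of the Lax pair normalized by $\varphi_\pm:=\phi_\pm e^{-i\theta\sigma_3}\to Y_\pm$ as $x\to\pm\infty$. They are considered column by column, for $z\in\mathbb C\setminus\{0,\pm iu_0\}$: the first column of $\phi_-$ and the second column of $\phi_+$ for $\operatorname{Re}z\operatorname{Im}z\ge 0$, the second column of $\phi_-$ and the first column of $\phi_+$ for $\operatorname{Re}z\operatorname{Im}z\le 0$ (so both columns on the real and imaginary axes). Then these columns exist and are unique for every $t$ and every such $z$; the function $u_0^2-|u(\cdot,t)|^2$ is integrable on every half-line; and with $$\nu_\pm(x,t)=\frac{1}{2\alpha}\int_{\pm\infty}^x\big(u_0^2-|u(y,t)|^2\big)\,dy$$ one has, for all fixed $x,t$ and with every column taken as $z$ tends to its limit within the region of that column, $$\varphi_\pm(x,t,z)=e^{i\nu_\pm(x,t)\sigma_3}+O(z^{-1})\quad(z\to\infty),\qquad \varphi_\pm(x,t,z)=\frac1z e^{i\nu_\pm(x,t)\sigma_3}\sigma_3Q_\pm+O(1)\quad(z\to0),$$ $$u(x,t)=\lim_{z\to\infty}\big(e^{i\nu_\pm(x,t)\sigma_3}\,z\,\varphi_\pm(x,t,z)\big)_{12}.$$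 -/

import Mathlib

open Filter Topology MeasureTheory Asymptotics
open scoped Matrix

noncomputable section

namespace MNLS

/-- The two spatial ends: `minus` is `x → -∞`, `plus` is `x → +∞`. -/
inductive Side : Type
  | minus : Side
  | plus : Side

/-- The filter on the line belonging to an end. -/
def Side.atEnd : Side → Filter ℝ
  | Side.minus => atBot
  | Side.plus => atTop

/-- A closed half-line reaching the given end. -/
def Side.halfLine : Side → Set ℝ
  | Side.minus => Set.Iic 0
  | Side.plus => Set.Ici 0

/-- The Pauli matrix `σ₃ = diag(1, -1)`. -/
def sigma3 : Matrix (Fin 2) (Fin 2) ℂ := !![1, 0; 0, -1]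

/-- `e^{i a σ₃} = diag(e^{i a}, e^{-i a})`. -/
def expISigma3 (a : ℂ) : Matrix (Fin 2) (Fin 2) ℂ :=
  !![Complex.exp (Complex.I * a), 0; 0, Complex.exp (-(Complex.I * a))]

/-- The potential matrix `Q` with upper right entry `v` and lower left entry `v*`. -/
def potQ (v : ℂ) : Matrix (Fin 2) (Fin 2) ℂ := !![0, v; (starRingEnd ℂ) v, 0]

/-- The spectral parameter `k(z) = (z - u₀²/z) / (2α)`. -/
def specK (α u₀ : ℝ) (z : ℂ) : ℂ := (z - (u₀ : ℂ) ^ 2 / z) / (2 * (α : ℂ))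

/-- The eigenvalue parameter `λ(z) = (z + u₀²/z) / 2`. -/
def specLam (u₀ : ℝ) (z : ℂ) : ℂ := (z + (u₀ : ℂ) ^ 2 / z) / 2

/-- The coefficient `X = -iαk²σ₃ + ikQ` of the spatial part `φ_x = X φ` of the Lax pair, at a
point where the potential has the value `v`. -/
def laxX (α u₀ : ℝ) (v z : ℂ) : Matrix (Fin 2) (Fin 2) ℂ :=
  (-(Complex.I * (α : ℂ) * specK α u₀ z ^ 2)) • sigma3 + (Complex.I * specK α u₀ z) • potQ v

/-- The eigenvector matrix `Y_± = I + z⁻¹ σ₃ Q_±`, where `v = u_±`. -/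
def eigY (v z : ℂ) : Matrix (Fin 2) (Fin 2) ℂ := 1 + z⁻¹ • (sigma3 * potQ v)

/-- The phase `θ = -kλ [x + (2αk² - 4α - u₀²/α) t]`. -/
def phase (α u₀ x t : ℝ) (z : ℂ) : ℂ :=
  -(specK α u₀ z * specLam u₀ z *
    ((x : ℂ) + (2 * (α : ℂ) * specK α u₀ z ^ 2 - 4 * (α : ℂ) - (u₀ : ℂ) ^ 2 / (α : ℂ)) * (t : ℂ)))

/-- The closed region on which column `j` of the Jost solution at the given end is defined:
the first column at `-∞` and the second column at `+∞` on `Re z Im z ≥ 0`, the other two on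
`Re z Im z ≤ 0`; the points `0` and `± i u₀` are removed. -/
def jostDomain (u₀ : ℝ) : Side → Fin 2 → Set ℂ
  | Side.minus, 0 => {z | z ≠ 0 ∧ z ^ 2 ≠ -(u₀ : ℂ) ^ 2 ∧ 0 ≤ z.re * z.im}
  | Side.minus, 1 => {z | z ≠ 0 ∧ z ^ 2 ≠ -(u₀ : ℂ) ^ 2 ∧ z.re * z.im ≤ 0}
  | Side.plus, 0 => {z | z ≠ 0 ∧ z ^ 2 ≠ -(u₀ : ℂ) ^ 2 ∧ z.re * z.im ≤ 0}
  | Side.plus, 1 => {z | z ≠ 0 ∧ z ^ 2 ≠ -(u₀ : ℂ) ^ 2 ∧ 0 ≤ z.re * z.im}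

/-- `f` is, as a function of `x` at the fixed time `t`, column `j` of the Jost solution at the end
`s`: it solves `f_x = X f` on the whole line, and after multiplication by the `j`-th diagonal entry
of `e^{-iθσ₃}` it tends to column `j` of `Y_±` at that end. -/
structure IsJostColumn (α u₀ : ℝ) (uInf : Side → ℂ) (u : ℝ → ℝ → ℂ) (s : Side) (t : ℝ) (z : ℂ)
    (j : Fin 2) (f : ℝ → Fin 2 → ℂ) : Prop where
  lax : ∀ x : ℝ, HasDerivAt f (laxX α u₀ (u x t) z *ᵥ f x) x
  normalized : Tendsto (fun x : ℝ => expISigma3 (-phase α u₀ x t z) j j • f x) s.atEnd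
    (𝓝 ((eigY (uInf s) z).col j))

/-- `φ` is the matrix Jost solution at the end `s`: each of its columns is the Jost column, at all
times and all `z` in the region belonging to that column. -/
def IsJost (α u₀ : ℝ) (uInf : Side → ℂ) (u : ℝ → ℝ → ℂ) (s : Side)
    (φ : ℝ → ℝ → ℂ → Matrix (Fin 2) (Fin 2) ℂ) : Prop :=
  ∀ (j : Fin 2) (t : ℝ), ∀ z ∈ jostDomain u₀ s j,
    IsJostColumn α u₀ uInf u s t z j (fun x => (φ x t z).col j)

/-- The modified Jost solution `φ e^{-iθσ₃}`. -/
def modifiedJost (α u₀ : ℝ) (φ : ℝ → ℝ → ℂ → Matrix (Fin 2) (Fin 2) ℂ) (x t : ℝ) (z : ℂ) :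
    Matrix (Fin 2) (Fin 2) ℂ :=
  φ x t z * expISigma3 (-phase α u₀ x t z)

/-- `ν_±(x,t) = (1/2α) ∫_{±∞}^x (u₀² - |u(y,t)|²) dy`. -/
def nu (α u₀ : ℝ) (u : ℝ → ℝ → ℂ) : Side → ℝ → ℝ → ℝ
  | Side.minus, x, t => 1 / (2 * α) * ∫ y in Set.Iic x, (u₀ ^ 2 - ‖u y t‖ ^ 2)
  | Side.plus, x, t => 1 / (2 * α) * -∫ y in Set.Ici x, (u₀ ^ 2 - ‖u y t‖ ^ 2)

end MNLS

end

/-! Each column at each end is treated separately. Reflecting the line when the end is `+∞`,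
multiplying by the normalizing exponential and, for the second column, exchanging the components
with a sign brings all four cases to one reduced system `IsReduced`: w' = κ₀(z - c/z) [[c/z, U], [V,
z]] w with w → (1, -V₀/z) at -∞, where c = u₀², U is u or its conjugate, and V is the conjugate of
U. Because U₀V₀ = c, the limiting matrix is z + c/z times an idempotent that kills the datum. On the
region of the column the exponent μ = κ₀(z - c/z)(z + c/z) has nonpositive real part, so a weighted
Volterra contraction (`existsUnique_perturbed`) gives existence and uniqueness, also on the boundary
of the region.

This contraction says nothing uniform as z → ∞, since the perturbation itself grows like z. Put κ =
κ₀(1 - c/z²), N(x) = ∫_{-∞}^x (c - UV), a = e^{-κN} w_0 and b = e^{κN}(z w_1 + V w_0). Then a' = αb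
and b' = μb + βa with (a, b) → (1, 0), where α is bounded and α', β have a common integrable
majorant for all large z. The combination αb - μa has a derivative free of μ, which yields a = 1 +
O(1/μ); a Riemann-Lebesgue argument with frequencies in a closed half-plane yields b → 0
(`offDiagonal_asymptotics`). Undoing the substitution, w_0 = e^{κ₀N} + O(1/z) with e^{κ₀N} =
e^{±iν}, and z w_1 + V w_0 → 0. For the second column the last limit recovers u.

The behaviour at z = 0 needs no new analysis. The map z ↦ -u₀²/z fixes k and reverses λ, so by
uniqueness it exchanges the two columns at the same end up to an explicit factor of order 1/z
(`modifiedJost_symm`), and carries the expansion at ∞ to the one at 0. -/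

noncomputable section

namespace MNLS

/-! ### Integrals over left half-lines. -/

section HalfLine

variable {E : Type*} [NormedAddCommGroup E]

/-- A continuous function with a limit at `-∞` is bounded on every left half-line. -/
theorem exists_bound_Iic_of_tendsto_atBot {f : ℝ → E} (hf : Continuous f) {l : E}
    (hl : Tendsto f atBot (𝓝 l)) (X : ℝ) : ∃ C, 0 ≤ C ∧ ∀ x ≤ X, ‖f x‖ ≤ C := by
  have h1 : ∀ᶠ x in atBot, ‖f x‖ ≤ ‖l‖ + 1 :=
    (hl.norm.eventually (gt_mem_nhds (lt_add_one _))).mono fun x hx => hx.le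
  obtain ⟨a, ha⟩ := eventually_atBot.1 h1
  obtain ⟨D, hD⟩ := (isCompact_Icc (a := a) (b := X)).exists_bound_of_continuousOn hf.continuousOn
  refine ⟨max (‖l‖ + 1) D, le_max_of_le_left (by positivity), fun x hx => ?_⟩
  rcases le_total x a with h | h
  · exact (ha x h).trans (le_max_left _ _)
  · exact (hD x ⟨h, hx⟩).trans (le_max_right _ _)

variable [NormedSpace ℝ E] [CompleteSpace E]

theorem hasDerivAt_integral_Iic {f : ℝ → E} (hf : Continuous f)
    (hi : ∀ x, IntegrableOn f (Set.Iic x)) (x : ℝ) :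
    HasDerivAt (fun x => ∫ y in Set.Iic x, f y) (f x) x := by
  have h : (fun x => ∫ y in Set.Iic x, f y)
      = fun x => (∫ y in Set.Iic (0 : ℝ), f y) + ∫ y in (0 : ℝ)..x, f y := by
    funext x
    rw [← intervalIntegral.integral_Iic_sub_Iic (hi 0) (hi x)]
    abel
  rw [h]
  exact (intervalIntegral.integral_hasDerivAt_right (hf.intervalIntegrable _ _)
    (hf.stronglyMeasurableAtFilter _ _) hf.continuousAt).const_add _

/-- The weight that turns a Volterra operator with kernel `m` into a contraction. -/
theorem integral_Iic_mul_exp_integral {m : ℝ → ℝ} (hm : Continuous m) (h0 : ∀ x, 0 ≤ m x)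
    (hi : ∀ x, IntegrableOn m (Set.Iic x)) {L : ℝ} (hL : 0 < L) (x : ℝ) :
    IntegrableOn (fun y => m y * Real.exp (L * ∫ s in Set.Iic y, m s)) (Set.Iic x) ∧
      ∫ y in Set.Iic x, m y * Real.exp (L * ∫ s in Set.Iic y, m s)
        = (Real.exp (L * ∫ s in Set.Iic x, m s) - 1) / L := by
  have hB := hasDerivAt_integral_Iic hm hi
  have hBc : Continuous fun y => ∫ s in Set.Iic y, m s :=
    continuous_iff_continuousAt.2 fun y => (hB y).continuousAt
  have hint : IntegrableOn (fun y => m y * Real.exp (L * ∫ s in Set.Iic y, m s)) (Set.Iic x) := by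
    refine ((hi x).mul_const (Real.exp (L * ∫ s in Set.Iic x, m s))).mono'
      (by fun_prop) ?_
    refine (ae_restrict_iff' measurableSet_Iic).2 (Eventually.of_forall fun y hy => ?_)
    rw [Real.norm_of_nonneg (mul_nonneg (h0 y) (Real.exp_pos _).le)]
    have : ∫ s in Set.Iic y, m s ≤ ∫ s in Set.Iic x, m s :=
      setIntegral_mono_set (hi x) (Eventually.of_forall h0)
        (Set.Iic_subset_Iic.2 hy).eventuallyLE
    have := h0 y
    gcongr
  refine ⟨hint, ?_⟩
  -- The integrand is an exact derivative, with boundary value 1/L at -∞.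
  have hd : ∀ y ∈ Set.Iic x, HasDerivAt (fun y => Real.exp (L * ∫ s in Set.Iic y, m s) / L)
      (m y * Real.exp (L * ∫ s in Set.Iic y, m s)) y := fun y _ => by
    have := ((hB y).const_mul L).exp.div_const L
    refine this.congr_deriv ?_
    field_simp
  have hlim : Tendsto (fun y => Real.exp (L * ∫ s in Set.Iic y, m s) / L) atBot
      (𝓝 (Real.exp (L * 0) / L)) :=
    (((tendsto_integral_Iic_zero (f := m) tendsto_id).const_mul L).rexp).div_const L
  rw [integral_Iic_of_hasDerivAt_of_tendsto' hd hint hlim]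
  simp [sub_div]

end HalfLine

/-! ### Linear equations with initial data at -∞. -/

section Volterra

variable {E : Type*} [NormedAddCommGroup E] [NormedSpace ℂ E]

/-- For an idempotent `R`, the group `e^{s μ R}`. -/
def flow (μ : ℂ) (R : E →L[ℂ] E) (s : ℝ) : E →L[ℂ] E := 1 + (Complex.exp (μ * s) - 1) • R

variable {μ : ℂ} {R : E →L[ℂ] E}

theorem flow_zero : flow μ R 0 = 1 := by simp [flow]

theorem flow_add (hR : R * R = R) (s t : ℝ) : flow μ R (s + t) = flow μ R s * flow μ R t := by
  simp only [flow, Complex.ofReal_add, mul_add, Complex.exp_add, add_mul, one_mul, mul_one,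
    smul_mul_assoc, mul_smul_comm, hR]
  module

theorem mul_flow (hR : R * R = R) (s : ℝ) : R * flow μ R s = Complex.exp (μ * s) • R := by
  simp only [flow, mul_add, mul_one, mul_smul_comm, hR]
  module

theorem hasDerivAt_flow_apply (hR : R * R = R) {v : ℝ → E} {v' : E} {x : ℝ}
    (hv : HasDerivAt v v' x) :
    HasDerivAt (fun x => flow μ R x (v x)) (μ • R (flow μ R x (v x)) + flow μ R x v') x := by
  have h1 : HasDerivAt (fun s : ℝ => Complex.exp (μ * s) - 1) (Complex.exp (μ * x) * μ) x := by
    have := ((((hasDerivAt_id x).ofReal_comp).const_mul μ).cexp).sub_const 1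
    simpa using this
  have h2 : HasDerivAt (fun x => R (v x)) (R v') x :=
    (R.restrictScalars ℝ).hasFDerivAt.comp_hasDerivAt x hv
  have h3 := hv.fun_add (h1.fun_smul h2)
  have h4 : R (flow μ R x (v x)) = Complex.exp (μ * x) • R (v x) := by
    rw [← mul_apply_eq_comp, mul_flow hR, _root_.smul_apply]
  have h5 : flow μ R x v' = v' + (Complex.exp (μ * x) - 1) • R v' := rfl
  refine h3.congr_deriv ?_
  rw [h4, h5]
  module

theorem flow_neg (s : ℝ) : flow μ R (-s) = flow (-μ) R s := by simp [flow]

theorem continuous_flow : Continuous (flow μ R) := by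
  unfold flow; fun_prop

theorem norm_flow_le (hμ : μ.re ≤ 0) {s : ℝ} (hs : 0 ≤ s) : ‖flow μ R s‖ ≤ 1 + 2 * ‖R‖ := by
  have h1 : ‖Complex.exp (μ * s)‖ ≤ 1 := by
    rw [Complex.norm_exp]
    simpa using mul_nonpos_of_nonpos_of_nonneg hμ hs
  calc ‖flow μ R s‖ ≤ ‖(1 : E →L[ℂ] E)‖ + ‖(Complex.exp (μ * s) - 1) • R‖ := norm_add_le _ _
    _ ≤ 1 + 2 * ‖R‖ := by
      rw [norm_smul]
      have h2 : ‖Complex.exp (μ * s) - 1‖ ≤ 2 := by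
        have := norm_sub_le (Complex.exp (μ * s)) 1
        rw [norm_one] at this
        linarith
      have := ContinuousLinearMap.norm_id_le (𝕜 := ℂ) (E := E)
      gcongr
      exact this

/-- Backward flows are not bounded by the sign of Re μ alone; splitting off the fixed factor at `-X`
leaves the forward time `X - y ≥ 0`. This makes the factored Duhamel integral converge. -/
theorem flow_neg_norm_le (hR : R * R = R) (hμ : μ.re ≤ 0) {X y : ℝ} (hy : y ≤ X) :
    ‖flow μ R (-y)‖ ≤ ‖flow μ R (-X)‖ * (1 + 2 * ‖R‖) := by
  have : flow μ R (-y) = flow μ R (-X) * flow μ R (X - y) := by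
    rw [← flow_add hR]; congr 1; ring
  rw [this]
  exact (norm_mul_le _ _).trans (by gcongr; exact norm_flow_le hμ (by linarith))

/-- The solution of `w' = μ R w + F` that vanishes at `-∞`. -/
def duhamel (μ : ℂ) (R : E →L[ℂ] E) (F : ℝ → E) (x : ℝ) : E :=
  flow μ R x (∫ y in Set.Iic x, flow μ R (-y) (F y))

theorem integrableOn_flow (hR : R * R = R) (hμ : μ.re ≤ 0) {F : ℝ → E} {X : ℝ}
    (hi : IntegrableOn F (Set.Iic X)) :
    IntegrableOn (fun y => flow μ R (-y) (F y)) (Set.Iic X) := by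
  refine (hi.norm.const_mul (‖flow μ R (-X)‖ * (1 + 2 * ‖R‖))).mono' ?_ ?_
  · have h : Continuous fun y : ℝ => flow μ R (-y) := continuous_flow.comp continuous_neg
    exact isBoundedBilinearMap_apply.continuous.comp_aestronglyMeasurable
      (h.aestronglyMeasurable.prodMk hi.aestronglyMeasurable)
  · refine (ae_restrict_iff' measurableSet_Iic).2 (Eventually.of_forall fun y hy => ?_)
    refine (ContinuousLinearMap.le_opNorm _ _).trans ?_
    gcongr
    exact flow_neg_norm_le hR hμ hy

theorem duhamel_sub (hR : R * R = R) (hμ : μ.re ≤ 0) {F G : ℝ → E} {x : ℝ}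
    (hF : IntegrableOn F (Set.Iic x)) (hG : IntegrableOn G (Set.Iic x)) :
    duhamel μ R (fun y => F y - G y) x = duhamel μ R F x - duhamel μ R G x := by
  simp only [duhamel, map_sub]
  rw [integral_sub (integrableOn_flow hR hμ hF) (integrableOn_flow hR hμ hG), map_sub]

theorem integrableOn_clm_apply_of_bounded {M : ℝ → E →L[ℂ] E} {w : ℝ → E}
    (hM : ∀ x, IntegrableOn M (Set.Iic x))
    (hw : Continuous w) (hb : ∀ X, ∃ C, ∀ x ≤ X, ‖w x‖ ≤ C) (X : ℝ) :
    IntegrableOn (fun x => M x (w x)) (Set.Iic X) := by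
  obtain ⟨C, hC⟩ := hb X
  refine ((hM X).norm.mul_const C).mono'
    (isBoundedBilinearMap_apply.continuous.comp_aestronglyMeasurable
      ((hM X).aestronglyMeasurable.prodMk hw.aestronglyMeasurable)) ?_
  refine (ae_restrict_iff' measurableSet_Iic).2 (Eventually.of_forall fun y hy => ?_)
  refine (ContinuousLinearMap.le_opNorm _ _).trans ?_
  gcongr
  exact hC y hy

variable [CompleteSpace E]

theorem hasDerivAt_duhamel (hR : R * R = R) (hμ : μ.re ≤ 0) {F : ℝ → E} (hF : Continuous F)
    (hi : ∀ x, IntegrableOn F (Set.Iic x)) (x : ℝ) :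
    HasDerivAt (duhamel μ R F) (μ • R (duhamel μ R F x) + F x) x := by
  have hc : Continuous fun y : ℝ => flow μ R (-y) (F y) :=
    (continuous_flow.comp continuous_neg).clm_apply hF
  have h : HasDerivAt (duhamel μ R F) _ x := hasDerivAt_flow_apply (μ := μ) hR
    (hasDerivAt_integral_Iic hc (fun X => integrableOn_flow hR hμ (hi X)) x)
  have h1 : flow μ R x (flow μ R (-x) (F x)) = F x := by
    have := flow_add (μ := μ) hR x (-x)
    rw [add_neg_cancel, flow_zero] at this
    rw [← mul_apply_eq_comp, ← this, one_apply_eq_self]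
  rwa [h1] at h

/-- Moving the outer flow inside the integral leaves only forward times x - y ≥ 0, so the constant
depends neither on x nor on μ. -/
theorem norm_duhamel_le (hR : R * R = R) (hμ : μ.re ≤ 0) {F : ℝ → E} {x : ℝ}
    (hi : IntegrableOn F (Set.Iic x)) :
    ‖duhamel μ R F x‖ ≤ (1 + 2 * ‖R‖) * ∫ y in Set.Iic x, ‖F y‖ := by
  have h : duhamel μ R F x = ∫ y in Set.Iic x, flow μ R (x - y) (F y) := by
    rw [duhamel, ← ContinuousLinearMap.integral_comp_comm _ (integrableOn_flow hR hμ hi)]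
    simp only [← mul_apply_eq_comp, ← flow_add hR, sub_eq_add_neg]
  rw [h, ← integral_const_mul]
  refine norm_integral_le_of_norm_le (hi.norm.const_mul _) ?_
  refine (ae_restrict_iff' measurableSet_Iic).2 (Eventually.of_forall fun y hy => ?_)
  refine (ContinuousLinearMap.le_opNorm _ _).trans ?_
  gcongr
  exact norm_flow_le hμ (by simpa using hy)

theorem tendsto_duhamel (hR : R * R = R) (hμ : μ.re ≤ 0) {F : ℝ → E}
    (hi : ∀ x, IntegrableOn F (Set.Iic x)) : Tendsto (duhamel μ R F) atBot (𝓝 0) := by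
  refine squeeze_zero_norm (fun x => norm_duhamel_le hR hμ (hi x)) ?_
  simpa using (tendsto_integral_Iic_zero (f := fun y => ‖F y‖) tendsto_id).const_mul (1 + 2 * ‖R‖)

/-- Variation of constants from `-∞`. -/
theorem eq_duhamel_of_hasDerivAt (hR : R * R = R) (hμ : μ.re ≤ 0) {F w : ℝ → E}
    (hF : Continuous F) (hi : ∀ x, IntegrableOn F (Set.Iic x))
    (hw : ∀ x, HasDerivAt w (μ • R (w x) + F x) x) (hlim : Tendsto w atBot (𝓝 0)) :
    w = duhamel μ R F := by
  set v : ℝ → E := fun x => w x - duhamel μ R F x with hv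
  have hv' : ∀ x, HasDerivAt v (μ • R (v x)) x := fun x => by
    convert (hw x).fun_sub (hasDerivAt_duhamel hR hμ hF hi x) using 1
    simp only [hv, map_sub, smul_sub]
    abel
  have hvlim : Tendsto v atBot (𝓝 0) := by simpa using hlim.sub (tendsto_duhamel hR hμ hi)
  -- Pulling the homogeneous solution back by the flow gives a constant; it is zero because the
  -- backward flow stays bounded as x → -∞ while `v` tends to 0.
  set c : ℝ → E := fun x => flow μ R (-x) (v x) with hc
  have hc' : ∀ x, HasDerivAt c 0 x := fun x => by
    have h := hasDerivAt_flow_apply (μ := -μ) hR (hv' x)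
    have hRf : R (flow (-μ) R x (v x)) = flow (-μ) R x (R (v x)) := by
      rw [← mul_apply_eq_comp, ← mul_apply_eq_comp]
      congr 1
      simp [flow, mul_add, add_mul]
    simp only [hc, flow_neg]
    convert h using 1
    rw [hRf, map_smul]
    simp
  have hcconst : ∀ x y, c x = c y := fun x y =>
    is_const_of_deriv_eq_zero (fun x => (hc' x).differentiableAt) (fun x => (hc' x).deriv) x y
  have hclim : Tendsto c atBot (𝓝 0) := by
    refine squeeze_zero_norm' (a := fun x => ‖flow μ R (-0)‖ * (1 + 2 * ‖R‖) * ‖v x‖) ?_ ?_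
    · filter_upwards [eventually_le_atBot 0] with x hx
      refine (ContinuousLinearMap.le_opNorm _ _).trans ?_
      gcongr
      exact flow_neg_norm_le hR hμ hx
    · simpa using hvlim.norm.const_mul (‖flow μ R (-0)‖ * (1 + 2 * ‖R‖))
  funext x
  have hc0 : c x = 0 := tendsto_nhds_unique
    (tendsto_const_nhds.congr fun y => hcconst x y) hclim
  have hvx : v x = 0 := by
    have := flow_add (μ := μ) hR x (-x)
    rw [add_neg_cancel, flow_zero] at this
    rw [← one_apply_eq_self (F := E →L[ℂ] E) (v x), this, mul_apply_eq_comp]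
    change flow μ R x (c x) = 0
    rw [hc0, map_zero]
  exact sub_eq_zero.1 hvx

section Perturbed

variable {M : ℝ → E →L[ℂ] E}

/-- A solution of the perturbed equation that vanishes at `-∞` is zero. -/
theorem eq_zero_of_perturbed (hR : R * R = R) (hμ : μ.re ≤ 0) (hMc : Continuous M)
    (hM : ∀ x, IntegrableOn M (Set.Iic x)) {w : ℝ → E}
    (hw : ∀ x, HasDerivAt w (μ • R (w x) + M x (w x)) x) (hlim : Tendsto w atBot (𝓝 0)) :
    w = 0 := by
  have hwc : Continuous w := continuous_iff_continuousAt.2 fun y => (hw y).continuousAt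
  have hb := exists_bound_Iic_of_tendsto_atBot hwc hlim
  have hFi := integrableOn_clm_apply_of_bounded hM hwc (fun X => (hb X).imp fun C h => h.2)
  have hrep := eq_duhamel_of_hasDerivAt hR hμ (hMc.clm_apply hwc) hFi hw hlim
  set C := 1 + 2 * ‖R‖ with hC
  have hCpos : 0 < C := by positivity
  set B : ℝ → ℝ := fun x => ∫ y in Set.Iic x, ‖M y‖ with hB
  have hkey := integral_Iic_mul_exp_integral hMc.norm (fun x => norm_nonneg _)
    (fun x => (hM x).norm) (L := 2 * C) (by positivity)
  -- The exponent 2C is chosen so that the Volterra operator halves any bound in the weighted norm;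
  -- iteration then forces the solution to vanish.
  have hhalf : ∀ X G, (∀ x ≤ X, ‖w x‖ ≤ G * Real.exp (2 * C * B x)) → 0 ≤ G →
      ∀ x ≤ X, ‖w x‖ ≤ (G / 2) * Real.exp (2 * C * B x) := fun X G hG hG0 x hx => by
    have h1 := norm_duhamel_le hR hμ (hFi x)
    rw [← hrep] at h1
    have h2 : ∫ y in Set.Iic x, ‖M y (w y)‖
        ≤ ∫ y in Set.Iic x, G * (‖M y‖ * Real.exp (2 * C * B y)) := by
      refine setIntegral_mono_on (hFi x).norm ((hkey x).1.const_mul G) measurableSet_Iic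
        fun y hy => ?_
      calc ‖M y (w y)‖ ≤ ‖M y‖ * ‖w y‖ := ContinuousLinearMap.le_opNorm _ _
        _ ≤ ‖M y‖ * (G * Real.exp (2 * C * B y)) := by
          gcongr; exact hG y (le_trans hy hx)
        _ = _ := by ring
    rw [integral_const_mul, (hkey x).2] at h2
    calc ‖w x‖ ≤ C * (G * ((Real.exp (2 * C * B x) - 1) / (2 * C))) := h1.trans (by gcongr)
      _ = (G / 2) * (Real.exp (2 * C * B x) - 1) := by field_simp
      _ ≤ _ := by gcongr; linarith
  funext X
  obtain ⟨G, hG0, hG⟩ := hb X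
  have hn : ∀ n : ℕ, ∀ x ≤ X, ‖w x‖ ≤ G * (1 / 2) ^ n * Real.exp (2 * C * B x) := fun n => by
    induction n with
    | zero =>
      intro x hx
      have hB0 : 0 ≤ B x := integral_nonneg fun y => norm_nonneg _
      have : 1 ≤ Real.exp (2 * C * B x) := Real.one_le_exp (by positivity)
      simpa using (hG x hx).trans (le_mul_of_one_le_right hG0 this)
    | succ n ih =>
      intro x hx
      convert hhalf X _ ih (by positivity) x hx using 2
      ring
  have hl : Tendsto (fun n : ℕ => G * (1 / 2 : ℝ) ^ n * Real.exp (2 * C * B X)) atTop (𝓝 0) := by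
    simpa using ((tendsto_pow_atTop_nhds_zero_of_lt_one (by norm_num : (0 : ℝ) ≤ 1 / 2)
      (by norm_num)).const_mul G).mul_const (Real.exp (2 * C * B X))
  have := ge_of_tendsto' hl fun n => hn n X le_rfl
  exact norm_le_zero_iff.1 this

theorem exists_perturbed (hR : R * R = R) (hμ : μ.re ≤ 0) (hMc : Continuous M)
    (hM : ∀ x, IntegrableOn M (Set.Iic x)) {w₀ : E} (hw₀ : R w₀ = 0) :
    ∃ w : ℝ → E, (∀ x, HasDerivAt w (μ • R (w x) + M x (w x)) x) ∧
      Tendsto w atBot (𝓝 w₀) := by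
  set C := 1 + 2 * ‖R‖ with hC
  have hCpos : 0 < C := by positivity
  set B : ℝ → ℝ := fun x => ∫ y in Set.Iic x, ‖M y‖ with hB
  have hkey := integral_Iic_mul_exp_integral hMc.norm (fun x => norm_nonneg _)
    (fun x => (hM x).norm) (L := 2 * C) (by positivity)
  have hBc : Continuous B := continuous_iff_continuousAt.2 fun y =>
    (hasDerivAt_integral_Iic hMc.norm (fun x => (hM x).norm) y).continuousAt
  have hBm : Monotone B := fun x y hxy => setIntegral_mono_set (hM y).norm
    (Eventually.of_forall fun _ => norm_nonneg _) (Set.Iic_subset_Iic.2 hxy).eventuallyLE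
  have hB0 : ∀ x, 0 ≤ B x := fun x => integral_nonneg fun y => norm_nonneg _
  -- The unknown is v = e^{-2CB} w. `M` is integrable only on left half-lines, so `B` and w may be
  -- unbounded towards +∞, but v is bounded on the whole line.
  set F : BoundedContinuousFunction ℝ E → ℝ → E :=
    fun v y => M y (Real.exp (2 * C * B y) • v y) with hFdef
  have hFc : ∀ v, Continuous (F v) := fun v => hMc.clm_apply (by fun_prop)
  have hFle : ∀ v y, ‖F v y‖ ≤ ‖v‖ * (‖M y‖ * Real.exp (2 * C * B y)) := fun v y => by
    refine (ContinuousLinearMap.le_opNorm _ _).trans ?_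
    rw [norm_smul, Real.norm_of_nonneg (Real.exp_pos _).le]
    have := v.norm_coe_le_norm y
    calc ‖M y‖ * (Real.exp (2 * C * B y) * ‖v y‖)
        ≤ ‖M y‖ * (Real.exp (2 * C * B y) * ‖v‖) := by gcongr
      _ = _ := by ring
  have hFi : ∀ v x, IntegrableOn (F v) (Set.Iic x) := fun v x =>
    ((hkey x).1.const_mul ‖v‖).mono' (hFc v).aestronglyMeasurable
      (Eventually.of_forall (hFle v))
  have hdle : ∀ v x, ‖Real.exp (-(2 * C * B x)) • duhamel μ R (F v) x‖ ≤ ‖v‖ / 2 := fun v x => by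
    rw [norm_smul, Real.norm_of_nonneg (Real.exp_pos _).le]
    have h2 : ∫ y in Set.Iic x, ‖F v y‖
        ≤ ∫ y in Set.Iic x, ‖v‖ * (‖M y‖ * Real.exp (2 * C * B y)) :=
      integral_mono (hFi v x).norm ((hkey x).1.const_mul _) (hFle v)
    rw [integral_const_mul, (hkey x).2] at h2
    calc Real.exp (-(2 * C * B x)) * ‖duhamel μ R (F v) x‖
        ≤ Real.exp (-(2 * C * B x))
          * (C * (‖v‖ * ((Real.exp (2 * C * B x) - 1) / (2 * C)))) := by
          gcongr
          exact (norm_duhamel_le hR hμ (hFi v x)).trans (by gcongr)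
      _ = (‖v‖ / 2) * (Real.exp (-(2 * C * B x)) * Real.exp (2 * C * B x)
            - Real.exp (-(2 * C * B x))) := by field_simp
      _ ≤ ‖v‖ / 2 := by
          rw [← Real.exp_add, neg_add_cancel, Real.exp_zero]
          have := Real.exp_pos (-(2 * C * B x))
          exact mul_le_of_le_one_right (by positivity) (by linarith)
  have hdc : ∀ v, Continuous (duhamel μ R (F v)) := fun v => continuous_iff_continuousAt.2 fun y =>
    (hasDerivAt_duhamel hR hμ (hFc v) (hFi v) y).continuousAt
  let T : BoundedContinuousFunction ℝ E → BoundedContinuousFunction ℝ E := fun v =>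
    BoundedContinuousFunction.ofNormedAddCommGroup
      (fun x => Real.exp (-(2 * C * B x)) • (w₀ + duhamel μ R (F v) x))
      (by have := hdc v; fun_prop) (‖w₀‖ + ‖v‖ / 2) (fun x => by
        rw [smul_add]
        refine (norm_add_le _ _).trans (add_le_add ?_ (hdle v x))
        rw [norm_smul, Real.norm_of_nonneg (Real.exp_pos _).le]
        have := hB0 x
        exact mul_le_of_le_one_left (norm_nonneg _)
          (Real.exp_le_one_iff.2 (neg_nonpos.2 (by positivity))))
  have hT : ContractingWith (1 / 2) T := by
    refine ⟨by rw [← NNReal.coe_lt_coe]; norm_num, LipschitzWith.of_dist_le_mul fun v v' => ?_⟩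
    refine (BoundedContinuousFunction.dist_le (by positivity)).2 fun x => ?_
    have h1 : T v x - T v' x = Real.exp (-(2 * C * B x)) • duhamel μ R (F (v - v')) x := by
      have : F (v - v') = fun y => F v y - F v' y := by
        funext y; simp [hFdef, smul_sub]
      rw [this, duhamel_sub hR hμ (hFi v x) (hFi v' x)]
      simp only [T, BoundedContinuousFunction.coe_ofNormedAddCommGroup, ← smul_sub]
      congr 1
      abel
    rw [dist_eq_norm, h1, dist_eq_norm]
    refine (hdle _ x).trans (le_of_eq ?_)
    simp; ring
  set v := ContractingWith.fixedPoint T hT with hv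
  have hfix : T v = v := hT.fixedPoint_isFixedPt
  set w : ℝ → E := fun x => w₀ + duhamel μ R (F v) x with hw
  have hwv : ∀ x, w x = Real.exp (2 * C * B x) • v x := fun x => by
    conv_rhs => rw [← hfix]
    simp only [T, BoundedContinuousFunction.coe_ofNormedAddCommGroup, smul_smul, ← Real.exp_add]
    simp [hw]
  refine ⟨w, fun x => ?_, ?_⟩
  -- The constant term contributes nothing to the μR part because `R w₀ = 0`.
  · convert (hasDerivAt_duhamel hR hμ (hFc v) (hFi v) x).const_add w₀ using 1
    rw [hwv x]
    change _ = _ + M x _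
    rw [← hwv x]
    simp [hw, hw₀]
  · simpa using (tendsto_duhamel hR hμ (hFi v)).const_add w₀

/-- Existence and uniqueness for the initial value problem at `-∞` of an integrable perturbation of
`w' = μ R w`, with `R` idempotent and `Re μ ≤ 0`. -/
theorem existsUnique_perturbed (hR : R * R = R) (hμ : μ.re ≤ 0) (hMc : Continuous M)
    (hM : ∀ x, IntegrableOn M (Set.Iic x)) {w₀ : E} (hw₀ : R w₀ = 0) :
    ∃! w : ℝ → E, (∀ x, HasDerivAt w (μ • R (w x) + M x (w x)) x) ∧
      Tendsto w atBot (𝓝 w₀) := by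
  obtain ⟨w, hw, hlim⟩ := exists_perturbed hR hμ hMc hM hw₀
  refine ⟨w, ⟨hw, hlim⟩, fun w' ⟨hw', hlim'⟩ => ?_⟩
  have := eq_zero_of_perturbed hR hμ hMc hM (w := fun x => w' x - w x) (fun x => ?_)
    (by simpa using hlim'.sub hlim)
  · exact sub_eq_zero.1 this
  · convert (hw' x).fun_sub (hw x) using 1
    simp only [map_sub, smul_sub]
    abel

end Perturbed

end Volterra

/-! ### Riemann-Lebesgue lemma in a closed half-plane. -/

section RiemannLebesgue

theorem norm_exp_mul_sub_le_one {μ : ℂ} (hμ : μ.re ≤ 0) {x s : ℝ} (hs : s ≤ x) :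
    ‖Complex.exp (μ * ((x : ℂ) - s))‖ ≤ 1 := by
  rw [Complex.norm_exp, ← Complex.ofReal_sub]
  simpa using mul_nonpos_of_nonpos_of_nonneg hμ (sub_nonneg.2 hs)

theorem hasDerivAt_exp_mul_sub (μ : ℂ) (x s : ℝ) :
    HasDerivAt (fun s : ℝ => Complex.exp (μ * ((x : ℂ) - s)))
      (-μ * Complex.exp (μ * ((x : ℂ) - s))) s := by
  have := ((((hasDerivAt_id s).ofReal_comp).const_sub (x : ℂ)).const_mul μ).cexp
  refine this.congr_deriv ?_
  simp [mul_comm]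

theorem integrableOn_exp_mul {μ : ℂ} (hμ : μ.re ≤ 0) {x : ℝ} {f : ℝ → ℂ}
    (hf : IntegrableOn f (Set.Iic x)) :
    IntegrableOn (fun s : ℝ => Complex.exp (μ * ((x : ℂ) - s)) * f s) (Set.Iic x) := by
  refine hf.norm.mono' (Continuous.aestronglyMeasurable (by fun_prop) |>.mul
    hf.aestronglyMeasurable) ?_
  refine (ae_restrict_iff' measurableSet_Iic).2 (Eventually.of_forall fun s hs => ?_)
  rw [norm_mul]
  exact mul_le_of_le_one_left (norm_nonneg _) (norm_exp_mul_sub_le_one hμ hs)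

theorem norm_integral_exp_mul_le {μ : ℂ} (hμ : μ.re ≤ 0) {x : ℝ} {f : ℝ → ℂ}
    (hf : IntegrableOn f (Set.Iic x)) :
    ‖∫ s in Set.Iic x, Complex.exp (μ * ((x : ℂ) - s)) * f s‖ ≤ ∫ s in Set.Iic x, ‖f s‖ := by
  refine norm_integral_le_of_norm_le hf.norm ?_
  refine (ae_restrict_iff' measurableSet_Iic).2 (Eventually.of_forall fun s hs => ?_)
  rw [norm_mul]
  exact mul_le_of_le_one_left (norm_nonneg _) (norm_exp_mul_sub_le_one hμ hs)

/-- Integration by parts trades the factor 1/μ for one derivative; compact support removes the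
boundary term at -∞. -/
theorem norm_integral_exp_mul_le_div {μ : ℂ} (hμ : μ.re ≤ 0) (hμ0 : μ ≠ 0) (x : ℝ) {g : ℝ → ℂ}
    (hg : ContDiff ℝ 1 g) (hc : HasCompactSupport g) :
    ‖∫ s in Set.Iic x, Complex.exp (μ * ((x : ℂ) - s)) * g s‖
      ≤ (‖g x‖ + ∫ s in Set.Iic x, ‖deriv g s‖) / ‖μ‖ := by
  have hg' : Continuous (deriv g) := hg.continuous_deriv_one
  have hgi : IntegrableOn g (Set.Iic x) :=
    (hg.continuous.integrable_of_hasCompactSupport hc).integrableOn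
  have hgi' : IntegrableOn (deriv g) (Set.Iic x) :=
    (hg'.integrable_of_hasCompactSupport hc.deriv).integrableOn
  have hd : ∀ s ∈ Set.Iic x, HasDerivAt (fun s : ℝ => Complex.exp (μ * ((x : ℂ) - s)) * g s)
      (Complex.exp (μ * ((x : ℂ) - s)) * deriv g s
        - μ * (Complex.exp (μ * ((x : ℂ) - s)) * g s)) s := fun s _ => by
    refine ((hasDerivAt_exp_mul_sub μ x s).mul
      (hg.differentiable one_ne_zero s).hasDerivAt).congr_deriv ?_
    ring
  have h1 := integrableOn_exp_mul hμ hgi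
  have h2 := integrableOn_exp_mul hμ hgi'
  have hlim : Tendsto (fun s : ℝ => Complex.exp (μ * ((x : ℂ) - s)) * g s) atBot (𝓝 0) := by
    refine tendsto_const_nhds.congr' ?_
    obtain ⟨a, ha⟩ := hc.isCompact.bddBelow
    filter_upwards [eventually_lt_atBot a] with s hs
    rw [image_eq_zero_of_notMem_tsupport (fun h => (ha h).not_gt hs), mul_zero]
  have h3 := integral_Iic_of_hasDerivAt_of_tendsto' hd (h2.sub (h1.const_mul μ)) hlim
  rw [integral_sub h2 (h1.const_mul μ), integral_const_mul] at h3
  have h4 : μ * ∫ s in Set.Iic x, Complex.exp (μ * ((x : ℂ) - s)) * g s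
      = (∫ s in Set.Iic x, Complex.exp (μ * ((x : ℂ) - s)) * deriv g s) - g x := by
    simp only [sub_self, mul_zero, Complex.exp_zero, one_mul, sub_zero] at h3
    rw [← h3]; ring
  rw [le_div_iff₀ (norm_pos_iff.2 hμ0), mul_comm, ← norm_mul, h4]
  refine (norm_sub_le _ _).trans ?_
  rw [add_comm]
  gcongr
  exact norm_integral_exp_mul_le hμ hgi'

/-- The Riemann-Lebesgue lemma for exponentials with frequencies in a closed half-plane. -/
theorem tendsto_integral_exp_mul {ι : Type*} {l : Filter ι} {μ : ι → ℂ}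
    (hμ : ∀ᶠ i in l, (μ i).re ≤ 0) (hinf : Tendsto (fun i => ‖μ i‖) l atTop) {x : ℝ} {f : ℝ → ℂ}
    (hf : IntegrableOn f (Set.Iic x)) :
    Tendsto (fun i => ∫ s in Set.Iic x, Complex.exp (μ i * ((x : ℂ) - s)) * f s) l (𝓝 0) := by
  rw [Metric.tendsto_nhds]
  intro ε hε
  -- Replacing `f` by a smooth compactly supported g costs at most ε/2 uniformly in the frequency,
  -- because the exponential has modulus at most 1.
  obtain ⟨g, hgc, hg, hfg⟩ := MemLp.exist_eLpNorm_sub_le (p := 1) (by simp) le_rfl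
    (memLp_one_iff_integrable.2 hf) (half_pos hε)
  have hg1 : ContDiff ℝ 1 g := hg.of_le (by exact_mod_cast le_top)
  have hgi : IntegrableOn g (Set.Iic x) :=
    (hg.continuous.integrable_of_hasCompactSupport hgc).integrableOn
  have hle : ∫ s in Set.Iic x, ‖f s - g s‖ ≤ ε / 2 := by
    rw [eLpNorm_one_eq_lintegral_enorm,
      ← ofReal_integral_norm_eq_lintegral_enorm (hf.sub hgi)] at hfg
    exact (ENNReal.ofReal_le_ofReal_iff (half_pos hε).le).1 hfg
  have hlim : Tendsto (fun i => (‖g x‖ + ∫ s in Set.Iic x, ‖deriv g s‖) / ‖μ i‖) l (𝓝 0) :=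
    hinf.const_div_atTop _
  filter_upwards [hμ, hlim.eventually_lt_const (half_pos hε), hinf.eventually_gt_atTop 0]
    with i hi1 hi2 hi3
  have h1 := norm_integral_exp_mul_le_div hi1 (norm_pos_iff.1 hi3) x hg1 hgc
  have h2 := norm_integral_exp_mul_le hi1 (hf.sub hgi)
  have h3 : ∫ s in Set.Iic x, Complex.exp (μ i * ((x : ℂ) - s)) * f s
      = (∫ s in Set.Iic x, Complex.exp (μ i * ((x : ℂ) - s)) * (f - g) s)
        + ∫ s in Set.Iic x, Complex.exp (μ i * ((x : ℂ) - s)) * g s := by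
    rw [← integral_add (integrableOn_exp_mul hi1 (hf.sub hgi)) (integrableOn_exp_mul hi1 hgi)]
    congr 1
    funext s
    simp only [Pi.sub_apply]
    ring
  rw [dist_zero_right, h3]
  refine (norm_add_le _ _).trans_lt ?_
  have h4 : ∫ s in Set.Iic x, ‖(f - g) s‖ ≤ ε / 2 := hle
  linarith

end RiemannLebesgue

/-! ### The off-diagonal system with a large parameter. -/

section OffDiagonal

variable {μ : ℂ} {α α' β a b : ℝ → ℂ}

/-- Variation of constants in scalar form: the integrating factor is bounded by 1, so the boundary
term at -∞ vanishes with `b`. -/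
theorem eq_integral_of_hasDerivAt (hμ : μ.re ≤ 0) {F : ℝ → ℂ}
    (hb : ∀ x, HasDerivAt b (μ * b x + F x) x) (hblim : Tendsto b atBot (𝓝 0)) {x : ℝ}
    (hF : IntegrableOn F (Set.Iic x)) :
    b x = ∫ s in Set.Iic x, Complex.exp (μ * ((x : ℂ) - s)) * F s := by
  have hd : ∀ s ∈ Set.Iic x, HasDerivAt (fun s : ℝ => Complex.exp (μ * ((x : ℂ) - s)) * b s)
      (Complex.exp (μ * ((x : ℂ) - s)) * F s) s := fun s _ => by
    refine ((hasDerivAt_exp_mul_sub μ x s).mul (hb s)).congr_deriv ?_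
    ring
  have hlim : Tendsto (fun s : ℝ => Complex.exp (μ * ((x : ℂ) - s)) * b s) atBot (𝓝 0) := by
    refine squeeze_zero_norm' (a := fun s => ‖b s‖) ?_ (by simpa using hblim.norm)
    filter_upwards [eventually_le_atBot x] with s hs
    rw [norm_mul]
    exact mul_le_of_le_one_left (norm_nonneg _) (norm_exp_mul_sub_le_one hμ hs)
  rw [integral_Iic_of_hasDerivAt_of_tendsto' hd (integrableOn_exp_mul hμ hF) hlim]
  simp

theorem integrableOn_mul_of_bounded {f g : ℝ → ℂ} {X C : ℝ} (hf : IntegrableOn f (Set.Iic X))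
    (hg : Continuous g) (hC : ∀ x ≤ X, ‖g x‖ ≤ C) :
    IntegrableOn (fun x => f x * g x) (Set.Iic X) := by
  refine (hf.norm.mul_const C).mono' (hf.aestronglyMeasurable.mul hg.aestronglyMeasurable) ?_
  refine (ae_restrict_iff' measurableSet_Iic).2 (Eventually.of_forall fun y hy => ?_)
  rw [norm_mul]
  gcongr
  exact hC y hy

/-- A priori bounds for the system `a' = α b`, `b' = μ b + β a` with a large parameter `μ` and data
`(1, 0)` at `-∞`: the coefficient `α` is only bounded, but its derivative is integrable. -/
theorem norm_sub_one_le_of_offDiagonal (hμ : μ.re ≤ 0) (hα : ∀ x, HasDerivAt α (α' x) x)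
    (ha : ∀ x, HasDerivAt a (α x * b x) x) (hb : ∀ x, HasDerivAt b (μ * b x + β x * a x) x)
    (halim : Tendsto a atBot (𝓝 1)) (hblim : Tendsto b atBot (𝓝 0)) {X C : ℝ} {m : ℝ → ℝ}
    (hm : IntegrableOn m (Set.Iic X)) (hα'i : IntegrableOn α' (Set.Iic X))
    (hβi : IntegrableOn β (Set.Iic X)) (hC : ∀ x ≤ X, ‖α x‖ ≤ C) (hα'm : ∀ x ≤ X, ‖α' x‖ ≤ m x)
    (hβm : ∀ x ≤ X, ‖β x‖ ≤ m x) {J : ℝ} (hJ : J = ∫ x in Set.Iic X, m x) (hμ0 : μ ≠ 0)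
    (hμJ : 2 * (2 * C * J + J ^ 2) ≤ ‖μ‖) {x : ℝ} (hx : x ≤ X) :
    ‖a x - 1‖ ≤ 2 * (2 * C * J + J ^ 2) / ‖μ‖ ∧ ‖a x‖ ≤ 2 ∧ ‖b x‖ ≤ 2 * J := by
  have hac : Continuous a := continuous_iff_continuousAt.2 fun y => (ha y).continuousAt
  have hbc : Continuous b := continuous_iff_continuousAt.2 fun y => (hb y).continuousAt
  have hαc : Continuous α := continuous_iff_continuousAt.2 fun y => (hα y).continuousAt
  obtain ⟨A₀, -, hA₀⟩ := exists_bound_Iic_of_tendsto_atBot hac halim X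
  obtain ⟨B₀, -, hB₀⟩ := exists_bound_Iic_of_tendsto_atBot hbc hblim X
  -- The supremum is finite because `a` is continuous with a limit at -∞; this is what permits
  -- absorbing it at the end.
  set A : ℝ := ⨆ y : Set.Iic X, ‖a y‖ with hA
  have hbdd : BddAbove (Set.range fun y : Set.Iic X => ‖a y‖) :=
    ⟨A₀, by rintro _ ⟨y, rfl⟩; exact hA₀ y y.2⟩
  have haA : ∀ y ≤ X, ‖a y‖ ≤ A := fun y hy => le_ciSup hbdd (⟨y, hy⟩ : Set.Iic X)
  have hA0 : 0 ≤ A := (norm_nonneg _).trans (haA X le_rfl)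
  have hC0 : 0 ≤ C := (norm_nonneg _).trans (hC X le_rfl)
  have hm0 : ∀ y ≤ X, 0 ≤ m y := fun y hy => (norm_nonneg _).trans (hβm y hy)
  have hJ0 : 0 ≤ J := hJ ▸ setIntegral_nonneg measurableSet_Iic hm0
  have hmJ : ∀ y ≤ X, ∫ s in Set.Iic y, m s ≤ J := fun y hy => by
    rw [hJ]
    refine setIntegral_mono_set hm ?_ (Set.Iic_subset_Iic.2 hy).eventuallyLE
    exact (ae_restrict_iff' measurableSet_Iic).2 (Eventually.of_forall hm0)
  have hsub : ∀ {y}, y ≤ X → Set.Iic y ⊆ Set.Iic X := fun hy => Set.Iic_subset_Iic.2 hy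
  have hβai := integrableOn_mul_of_bounded hβi hac hA₀
  have hbA : ∀ y ≤ X, ‖b y‖ ≤ J * A := fun y hy => by
    rw [eq_integral_of_hasDerivAt hμ hb hblim (hβai.mono_set (hsub hy))]
    refine (norm_integral_exp_mul_le hμ (hβai.mono_set (hsub hy))).trans ?_
    have h1 : ∫ s in Set.Iic y, ‖β s * a s‖ ≤ ∫ s in Set.Iic y, m s * A := by
      refine setIntegral_mono_on (hβai.mono_set (hsub hy)).norm
        ((hm.mono_set (hsub hy)).mul_const A) measurableSet_Iic fun s hs => ?_
      have hsX : s ≤ X := le_trans hs hy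
      rw [norm_mul]
      exact mul_le_mul (hβm s hsX) (haA s hsX) (norm_nonneg _) (hm0 s hsX)
    rw [integral_mul_const] at h1
    exact h1.trans (by gcongr; exact hmJ y hy)
  have hα'bi := integrableOn_mul_of_bounded hα'i hbc hB₀
  have hαβai : IntegrableOn (fun s => β s * a s * α s) (Set.Iic X) :=
    integrableOn_mul_of_bounded hβai hαc hC
  have hint := hα'bi.add hαβai
  have haA1 : ∀ y ≤ X, ‖a y - 1‖ ≤ (2 * C * J + J ^ 2) / ‖μ‖ * A := fun y hy => by
    -- The terms μαb cancel in this derivative. Integrating from -∞ therefore expresses μ(a - 1) by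
    -- quantities bounded independently of μ.
    have hd : ∀ s ∈ Set.Iic y, HasDerivAt (fun s => α s * b s - μ * a s)
        (α' s * b s + β s * a s * α s) s := fun s _ => by
      refine (((hα s).mul (hb s)).sub ((ha s).const_mul μ)).congr_deriv ?_
      ring
    have hlim : Tendsto (fun s => α s * b s - μ * a s) atBot (𝓝 (0 - μ * 1)) := by
      refine Tendsto.sub ?_ (halim.const_mul μ)
      refine squeeze_zero_norm' (a := fun s => C * ‖b s‖) ?_ (by simpa using hblim.norm.const_mul C)
      filter_upwards [eventually_le_atBot X] with s hs
      rw [norm_mul]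
      gcongr
      exact hC s hs
    have h1 := integral_Iic_of_hasDerivAt_of_tendsto' hd (hint.mono_set (hsub hy)) hlim
    have h2 : ‖∫ s in Set.Iic y, (α' s * b s + β s * a s * α s)‖
        ≤ ∫ s in Set.Iic y, m s * (J * A + C * A) := by
      refine norm_integral_le_of_norm_le ((hm.mono_set (hsub hy)).mul_const _) ?_
      refine (ae_restrict_iff' measurableSet_Iic).2 (Eventually.of_forall fun s hs => ?_)
      have hsX : s ≤ X := le_trans hs hy
      have hms := hm0 s hsX
      refine (norm_add_le _ _).trans ?_
      rw [norm_mul, norm_mul, norm_mul, mul_add]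
      refine add_le_add (mul_le_mul (hα'm s hsX) (hbA s hsX) (norm_nonneg _) hms) ?_
      calc ‖β s‖ * ‖a s‖ * ‖α s‖ ≤ m s * A * C := by
            gcongr
            exacts [hβm s hsX, haA s hsX, hC s hsX]
        _ = m s * (C * A) := by ring
    rw [integral_mul_const] at h2
    have h3 : ‖μ * (a y - 1)‖ ≤ (2 * C * J + J ^ 2) * A := by
      have h4 : μ * (a y - 1)
          = α y * b y - ∫ s in Set.Iic y, (α' s * b s + β s * a s * α s) := by
        rw [h1]; ring
      rw [h4]
      refine (norm_sub_le _ _).trans ?_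
      have h5 : ‖α y * b y‖ ≤ C * (J * A) := by
        rw [norm_mul]
        exact mul_le_mul (hC y hy) (hbA y hy) (norm_nonneg _) hC0
      have h6 : (∫ s in Set.Iic y, m s) * (J * A + C * A) ≤ J * (J * A + C * A) := by
        gcongr; exact hmJ y hy
      nlinarith
    rw [norm_mul] at h3
    rw [div_mul_eq_mul_div, le_div_iff₀ (norm_pos_iff.2 hμ0), mul_comm]
    exact h3
  have hμpos : 0 < ‖μ‖ := norm_pos_iff.2 hμ0
  have hA2 : A ≤ 2 := by
    have hhalf : (2 * C * J + J ^ 2) / ‖μ‖ ≤ 1 / 2 := by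
      rw [div_le_iff₀ hμpos]; linarith
    -- The size condition on μ makes the coefficient of `A` at most 1/2, so `A` can be absorbed.
    have : A ≤ 1 + 1 / 2 * A := by
      have : Nonempty (Set.Iic X) := ⟨⟨X, Set.self_mem_Iic⟩⟩
      refine ciSup_le fun y => ?_
      have h1 := haA1 y y.2
      have h2 : ‖a y‖ ≤ ‖a y - 1‖ + ‖(1 : ℂ)‖ := by
        simpa using norm_add_le (a y - 1) 1
      rw [norm_one] at h2
      have h3 : (2 * C * J + J ^ 2) / ‖μ‖ * A ≤ 1 / 2 * A := by gcongr
      linarith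
    linarith
  refine ⟨(haA1 x hx).trans ?_, (haA x hx).trans hA2, (hbA x hx).trans ?_⟩
  · calc (2 * C * J + J ^ 2) / ‖μ‖ * A ≤ (2 * C * J + J ^ 2) / ‖μ‖ * 2 := by gcongr
      _ = _ := by ring
  · calc J * A ≤ J * 2 := by gcongr
      _ = _ := mul_comm _ _

/-- Asymptotics of the system `a' = α b`, `b' = μ b + β a` as `μ → ∞` in the left half-plane. -/
theorem offDiagonal_asymptotics {ι : Type*} {l : Filter ι} [l.IsCountablyGenerated]
    {μ : ι → ℂ} {α α' β a b : ι → ℝ → ℂ} {β₀ : ℝ → ℂ} {X C : ℝ} {m : ℝ → ℝ}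
    (hμ : ∀ᶠ i in l, (μ i).re ≤ 0) (hinf : Tendsto (fun i => ‖μ i‖) l atTop)
    (hα : ∀ᶠ i in l, ∀ x, HasDerivAt (α i) (α' i x) x)
    (ha : ∀ᶠ i in l, ∀ x, HasDerivAt (a i) (α i x * b i x) x)
    (hb : ∀ᶠ i in l, ∀ x, HasDerivAt (b i) (μ i * b i x + β i x * a i x) x)
    (halim : ∀ᶠ i in l, Tendsto (a i) atBot (𝓝 1))
    (hblim : ∀ᶠ i in l, Tendsto (b i) atBot (𝓝 0))
    (hm : IntegrableOn m (Set.Iic X))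
    (hα'i : ∀ᶠ i in l, IntegrableOn (α' i) (Set.Iic X))
    (hβi : ∀ᶠ i in l, IntegrableOn (β i) (Set.Iic X))
    (hC : ∀ᶠ i in l, ∀ x ≤ X, ‖α i x‖ ≤ C) (hα'm : ∀ᶠ i in l, ∀ x ≤ X, ‖α' i x‖ ≤ m x)
    (hβm : ∀ᶠ i in l, ∀ x ≤ X, ‖β i x‖ ≤ m x)
    (hβ₀ : IntegrableOn β₀ (Set.Iic X))
    (hlim : ∀ x ≤ X, Tendsto (fun i => β i x) l (𝓝 (β₀ x))) :
    (fun i => a i X - 1) =O[l] (fun i => (μ i)⁻¹) ∧ Tendsto (fun i => b i X) l (𝓝 0) := by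
  set J : ℝ := ∫ x in Set.Iic X, m x with hJ
  have hall : ∀ᶠ i in l, ∀ x ≤ X,
      ‖a i x - 1‖ ≤ 2 * (2 * C * J + J ^ 2) / ‖μ i‖ ∧ ‖a i x‖ ≤ 2 ∧ ‖b i x‖ ≤ 2 * J := by
    filter_upwards [hμ, hα, ha, hb, halim, hblim, hα'i, hβi, hC, hα'm, hβm,
      hinf.eventually_gt_atTop 0, hinf.eventually_ge_atTop (2 * (2 * C * J + J ^ 2))]
      with i h1 h2 h3 h4 h5 h6 h7 h8 h9 h10 h11 h12 h13 x hx
    exact norm_sub_one_le_of_offDiagonal h1 h2 h3 h4 h5 h6 hm h7 h8 h9 h10 h11 hJ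
      (norm_pos_iff.1 h12) h13 hx
  have halim' : ∀ x ≤ X, Tendsto (fun i => a i x) l (𝓝 1) := fun x hx => by
    rw [tendsto_iff_norm_sub_tendsto_zero]
    refine squeeze_zero' (Eventually.of_forall fun _ => norm_nonneg _)
      (hall.mono fun i h => (h x hx).1) (hinf.const_div_atTop _)
  have hai : ∀ᶠ i in l, IntegrableOn (fun x => β i x * a i x) (Set.Iic X) := by
    filter_upwards [hall, hβi, ha] with i h1 h2 h3
    exact integrableOn_mul_of_bounded h2
      (continuous_iff_continuousAt.2 fun y => (h3 y).continuousAt) fun x hx => (h1 x hx).2.1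
  refine ⟨IsBigO.of_bound (2 * (2 * C * J + J ^ 2)) ?_, ?_⟩
  · filter_upwards [hall] with i h
    rw [norm_inv, ← div_eq_mul_inv]
    exact (h X le_rfl).1
  -- The source of b converges to the fixed function `β₀` in L¹. Its error is harmless under a
  -- kernel bounded by 1, and Riemann-Lebesgue handles `β₀` itself.
  · have hdct : Tendsto (fun i => ∫ x in Set.Iic X, ‖β i x * a i x - β₀ x‖) l (𝓝 0) := by
      have := tendsto_integral_filter_of_dominated_convergence (μ := volume.restrict (Set.Iic X))
        (F := fun i x => ‖β i x * a i x - β₀ x‖) (f := fun _ => (0 : ℝ)) (l := l)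
        (fun x => m x * 2 + ‖β₀ x‖)
        (hai.mono fun i h => (h.sub hβ₀).norm.aestronglyMeasurable) ?_
        ((hm.mul_const 2).add hβ₀.norm) ?_
      · simpa using this
      · filter_upwards [hall, hβm] with i h1 h2
        refine (ae_restrict_iff' measurableSet_Iic).2 (Eventually.of_forall fun x hx => ?_)
        rw [norm_norm]
        refine (norm_sub_le _ _).trans ?_
        rw [norm_mul]
        gcongr
        exacts [(norm_nonneg _).trans (h2 x hx), h2 x hx, (h1 x hx).2.1]
      · refine (ae_restrict_iff' measurableSet_Iic).2 (Eventually.of_forall fun x hx => ?_)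
        have := ((hlim x hx).mul (halim' x hx)).sub_const (β₀ x)
        simpa using this.norm
    have h1 : Tendsto (fun i => ∫ s in Set.Iic X,
        Complex.exp (μ i * ((X : ℂ) - s)) * (β i s * a i s - β₀ s)) l (𝓝 0) := by
      refine squeeze_zero_norm' ?_ hdct
      filter_upwards [hai, hμ] with i h1 h2
      exact norm_integral_exp_mul_le h2 (h1.sub hβ₀)
    have h2 := h1.add (tendsto_integral_exp_mul hμ hinf hβ₀)
    rw [add_zero] at h2
    refine h2.congr' ?_
    filter_upwards [hai, hμ, hb, hblim] with i h3 h4 h5 h6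
    have h7 := integrableOn_exp_mul h4 (h3.sub hβ₀)
    simp only [Pi.sub_apply] at h7
    rw [eq_integral_of_hasDerivAt h4 h5 h6 h3, ← integral_add h7 (integrableOn_exp_mul h4 hβ₀)]
    congr 1
    funext s
    ring

end OffDiagonal

/-! ### The reduced system: solvability and large-z asymptotics. -/

section Reduced

/-- A differentiable function with integrable derivative and a limit at `-∞`, approached in
`L¹`. -/
structure IsProfile (f : ℝ → ℂ) (f₀ : ℂ) : Prop where
  diff : Differentiable ℝ f
  deriv_int : Integrable (deriv f)
  lim : Tendsto f atBot (𝓝 f₀)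
  int : ∀ x, IntegrableOn (fun y => f y - f₀) (Set.Iic x)

/-- The pair of potentials of the reduced system. -/
structure IsPotential (c : ℂ) (U V : ℝ → ℂ) (U₀ V₀ : ℂ) : Prop where
  fst : IsProfile U U₀
  snd : IsProfile V V₀
  mul_eq : U₀ * V₀ = c

/-- The reduced form of the spatial equation for one column of a Jost solution. -/
structure IsReduced (c κ₀ : ℂ) (U V : ℝ → ℂ) (V₀ z : ℂ) (w : ℝ → Fin 2 → ℂ) : Prop where
  eq : ∀ x, HasDerivAt w ((κ₀ * (z - c / z)) • (!![c / z, U x; V x, z] *ᵥ w x)) x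
  lim : Tendsto w atBot (𝓝 ![1, -V₀ / z])

variable {c κ₀ : ℂ} {U V : ℝ → ℂ} {U₀ V₀ : ℂ}

/-- With c = U₀V₀ the defect equals -(V - V₀)U - V₀(U - U₀): an integrable factor times a bounded
one in each term. -/
theorem IsPotential.integrableOn_defect (h : IsPotential c U V U₀ V₀) (x : ℝ) :
    IntegrableOn (fun y => c - U y * V y) (Set.Iic x) := by
  obtain ⟨C, -, hC⟩ := exists_bound_Iic_of_tendsto_atBot h.fst.diff.continuous h.fst.lim x
  have h1 := (integrableOn_mul_of_bounded (h.snd.int x) h.fst.diff.continuous hC).neg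
  have h2 := (h.fst.int x).mul_const (-V₀)
  refine (h1.add h2).congr (Eventually.of_forall fun y => ?_)
  simp only [Pi.add_apply, Pi.neg_apply, ← h.mul_eq]
  ring

theorem IsReduced.hasDerivAt {z : ℂ} {w : ℝ → Fin 2 → ℂ} (hw : IsReduced c κ₀ U V V₀ z w)
    (x : ℝ) :
    HasDerivAt (fun x => w x 0) (κ₀ * (z - c / z) * (c / z * w x 0 + U x * w x 1)) x ∧
      HasDerivAt (fun x => w x 1) (κ₀ * (z - c / z) * (V x * w x 0 + z * w x 1)) x := by
  have h := hasDerivAt_pi.1 (hw.eq x)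
  refine ⟨(h 0).congr_deriv ?_, (h 1).congr_deriv ?_⟩ <;>
    simp [dotProduct, Fin.sum_univ_two]

theorem integrableOn_smul_add_smul {E : Type*} [NormedAddCommGroup E] [NormedSpace ℂ E]
    {f g : ℝ → ℂ} {s : Set ℝ} (hf : IntegrableOn f s) (hg : IntegrableOn g s) (A B : E) :
    IntegrableOn (fun y => f y • A + g y • B) s :=
  (hf.smul_const A).add (hg.smul_const B)

/-- The limiting matrix has determinant c - U₀V₀ = 0 and trace z + c/z, which is nonzero since z² ≠
-c. Divided by its trace it is idempotent, and the prescribed limit spans its kernel; what remains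
is an integrable off-diagonal perturbation. -/
theorem existsUnique_isReduced (h : IsPotential c U V U₀ V₀) {z : ℂ} (hz : z ≠ 0)
    (hz2 : z ^ 2 ≠ -c) (hre : (κ₀ * (z - c / z) * (z + c / z)).re ≤ 0) :
    ∃! w, IsReduced c κ₀ U V V₀ z w := by
  set K := κ₀ * (z - c / z) with hK
  have hs : z + c / z ≠ 0 := fun h0 => hz2 (by
    have : z * (z + c / z) = 0 := by rw [h0, mul_zero]
    rw [mul_add, mul_div_cancel₀ _ hz] at this
    rw [sq]; exact eq_neg_of_add_eq_zero_left this)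
  let toCLM : Matrix (Fin 2) (Fin 2) ℂ →ₗ[ℂ] ((Fin 2 → ℂ) →L[ℂ] (Fin 2 → ℂ)) :=
    (LinearMap.toContinuousLinearMap.toLinearMap).comp (Matrix.toLin').toLinearMap
  have htc : ∀ A v, toCLM A v = A *ᵥ v := fun A v => rfl
  have hmul : ∀ A B, toCLM A * toCLM B = toCLM (A * B) := fun A B => by
    refine ContinuousLinearMap.ext fun v => ?_
    rw [mul_apply_eq_comp, htc, htc, htc, Matrix.mulVec_mulVec]
  set R := toCLM ((z + c / z)⁻¹ • !![c / z, U₀; V₀, z]) with hRdef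
  set M : ℝ → (Fin 2 → ℂ) →L[ℂ] (Fin 2 → ℂ) := fun x =>
    (K * (U x - U₀)) • toCLM !![0, 1; 0, 0] + (K * (V x - V₀)) • toCLM !![0, 0; 1, 0] with hM
  have hR : R * R = R := by
    -- Cayley-Hamilton for a singular matrix: the square is the trace times the matrix.
    have hA : (!![c / z, U₀; V₀, z] : Matrix (Fin 2) (Fin 2) ℂ) * !![c / z, U₀; V₀, z]
        = (z + c / z) • !![c / z, U₀; V₀, z] := by
      have h1 := h.mul_eq
      have h2 : c / z * z = c := div_mul_cancel₀ c hz
      generalize c / z = d at h2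
      ext i j
      fin_cases i <;> fin_cases j <;> simp [Matrix.mul_apply, Fin.sum_univ_two]
      · linear_combination h1 - h2
      · ring
      · ring
      · linear_combination h1 - h2
    rw [hRdef, hmul, smul_mul_smul_comm, hA, smul_smul, mul_assoc, inv_mul_cancel₀ hs, mul_one]
  have hMc : Continuous M := by
    have := h.fst.diff.continuous
    have := h.snd.diff.continuous
    fun_prop
  have hMi : ∀ x, IntegrableOn M (Set.Iic x) := fun x =>
    integrableOn_smul_add_smul ((h.fst.int x).const_mul K) ((h.snd.int x).const_mul K) _ _
  have hw₀ : R ![1, -V₀ / z] = 0 := by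
    rw [hRdef, htc, Matrix.smul_mulVec]
    have := h.mul_eq
    have h2 : (!![c / z, U₀; V₀, z] : Matrix (Fin 2) (Fin 2) ℂ) *ᵥ ![1, -V₀ / z] = 0 := by
      ext i
      fin_cases i <;> simp [Matrix.mulVec, dotProduct, Fin.sum_univ_two]
      · rw [← h.mul_eq]; ring
      · field_simp; ring
    rw [h2, smul_zero]
  have hkey := existsUnique_perturbed (μ := K * (z + c / z)) hR hre hMc hMi hw₀
  refine (existsUnique_congr fun w => ?_).1 hkey
  have hco : ∀ x, (K * (z + c / z)) • R (w x) + M x (w x)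
      = K • (!![c / z, U x; V x, z] *ᵥ w x) := fun x => by
    simp only [hM, hRdef, _root_.add_apply, _root_.smul_apply, htc, Matrix.smul_mulVec, smul_smul]
    rw [mul_assoc, mul_inv_cancel₀ hs]
    ext i
    fin_cases i <;> simp [dotProduct, Fin.sum_univ_two] <;> ring
  simp only [hco]
  exact ⟨fun h => ⟨h.1, h.2⟩, fun h => ⟨h.1, h.2⟩⟩

/-- The off-diagonal form of the reduced system, obtained from `z w₁ + V w₀` and an exponential
gauge. -/
theorem IsReduced.offDiagonal {z : ℂ} (hz : z ≠ 0) {w : ℝ → Fin 2 → ℂ}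
    (hw : IsReduced c κ₀ U V V₀ z w) (hU : Differentiable ℝ U) (hV : Differentiable ℝ V)
    {N : ℝ → ℂ} (hN : ∀ x, HasDerivAt N (c - U x * V x) x) {κ : ℂ}
    (hκ : κ = κ₀ * (1 - c * (z⁻¹) ^ 2)) (x : ℝ) :
    HasDerivAt (fun x => κ * U x * Complex.exp (-(2 * κ * N x)))
        (κ * (deriv U x - 2 * κ * (c - U x * V x) * U x) * Complex.exp (-(2 * κ * N x))) x ∧
      HasDerivAt (fun x => Complex.exp (-(κ * N x)) * w x 0)
        (κ * U x * Complex.exp (-(2 * κ * N x))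
          * (Complex.exp (κ * N x) * (z * w x 1 + V x * w x 0))) x ∧
      HasDerivAt (fun x => Complex.exp (κ * N x) * (z * w x 1 + V x * w x 0))
        (κ * (z ^ 2 + c) * (Complex.exp (κ * N x) * (z * w x 1 + V x * w x 0))
          + (deriv V x + κ * V x * (c - U x * V x)) * Complex.exp (2 * κ * N x)
            * (Complex.exp (-(κ * N x)) * w x 0)) x := by
  obtain ⟨h0, h1⟩ := hw.hasDerivAt x
  -- One power of z is split off so that κ stays bounded as z → ∞; that power is absorbed by z w_1.
  have hK : κ₀ * (z - c / z) = κ * z := by rw [hκ]; field_simp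
  rw [hK] at h0 h1
  have hUx := (hU x).hasDerivAt
  have hVx := (hV x).hasDerivAt
  have hE := ((hN x).const_mul κ).cexp
  have hE' := ((hN x).const_mul κ).fun_neg.cexp
  have hE2 := ((hN x).const_mul (2 * κ)).fun_neg.cexp
  have e1 : Complex.exp (-(2 * κ * N x)) * Complex.exp (κ * N x) = Complex.exp (-(κ * N x)) := by
    rw [← Complex.exp_add]; ring_nf
  have e2 : Complex.exp (2 * κ * N x) * Complex.exp (-(κ * N x)) = Complex.exp (κ * N x) := by
    rw [← Complex.exp_add]; ring_nf
  refine ⟨?_, ?_, ?_⟩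
  · refine ((hUx.const_mul κ).fun_mul hE2).congr_deriv ?_
    ring
  · refine (hE'.fun_mul h0).congr_deriv ?_
    rw [mul_assoc (κ * U x), ← mul_assoc (Complex.exp (-(2 * κ * N x))), e1]
    field_simp
    ring
  · refine (hE.fun_mul ((h1.const_mul z).fun_add (hVx.fun_mul h0))).congr_deriv ?_
    rw [← mul_assoc _ (Complex.exp (-(κ * N x))), mul_assoc _ (Complex.exp (2 * κ * N x)), e2]
    field_simp
    ring

theorem tendsto_inv_of_le_cobounded {l : Filter ℂ} (hl : l ≤ Bornology.cobounded ℂ) :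
    Tendsto (fun z : ℂ => z⁻¹) l (𝓝 0) ∧ ∀ᶠ z : ℂ in l, z ≠ 0 :=
  ⟨tendsto_inv₀_cobounded.mono_left hl,
    (hl (Bornology.eventually_ne_cobounded 0))⟩

/-- Asymptotics of the solution of the reduced system as `z → ∞`. -/
theorem IsReduced.asymptotics {l : Filter ℂ} [l.IsCountablyGenerated]
    (hl : l ≤ Bornology.cobounded ℂ) (hp : IsPotential c U V U₀ V₀) (hκ₀ : κ₀ ≠ 0)
    {w : ℂ → ℝ → Fin 2 → ℂ} (hw : ∀ᶠ z in l, IsReduced c κ₀ U V V₀ z (w z))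
    (hre : ∀ᶠ z in l, (κ₀ * (z - c / z) * (z + c / z)).re ≤ 0) (x : ℝ) :
    (fun z => w z x 0 - Complex.exp (κ₀ * ∫ y in Set.Iic x, (c - U y * V y)))
        =O[l] (fun z => z⁻¹) ∧
      (fun z => w z x 1) =O[l] (fun z => z⁻¹) ∧
      Tendsto (fun z => z * w z x 1 + V x * w z x 0) l (𝓝 0) := by
  obtain ⟨hinv, hne⟩ := tendsto_inv_of_le_cobounded hl
  have hUc := hp.fst.diff.continuous
  have hVc := hp.snd.diff.continuous
  have hQc : Continuous fun y => c - U y * V y := by fun_prop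
  set N : ℝ → ℂ := fun x => ∫ y in Set.Iic x, (c - U y * V y) with hNdef
  have hN := hasDerivAt_integral_Iic hQc hp.integrableOn_defect
  have hNlim : Tendsto N atBot (𝓝 0) := tendsto_integral_Iic_zero tendsto_id
  have hNc : Continuous N := continuous_iff_continuousAt.2 fun y => (hN y).continuousAt
  -- κ tends to κ₀, and μ = κ(z² + c) is the same exponent as in the solvability argument,
  -- asymptotic to κ₀z².
  set κ : ℂ → ℂ := fun z => κ₀ * (1 - c * (z⁻¹) ^ 2) with hκdef
  have hκlim : Tendsto κ l (𝓝 κ₀) := by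
    have := (((hinv.pow 2).const_mul c).const_sub 1).const_mul κ₀
    rwa [zero_pow two_ne_zero, mul_zero, sub_zero, mul_one] at this
  set μ : ℂ → ℂ := fun z => κ z * (z ^ 2 + c) with hμdef
  have hμre : ∀ᶠ z in l, (μ z).re ≤ 0 := by
    filter_upwards [hre, hne] with z h1 h2
    convert h1 using 2
    simp only [hμdef, hκdef]
    field_simp
  have hrat : Tendsto (fun z => κ z * (1 + c * (z⁻¹) ^ 2)) l (𝓝 κ₀) := by
    simpa using hκlim.mul (((hinv.pow 2).const_mul c).const_add 1)
  have hμeq : ∀ᶠ z in l, μ z = κ z * (1 + c * (z⁻¹) ^ 2) * z ^ 2 := by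
    filter_upwards [hne] with z hz
    simp only [hμdef]
    field_simp
  have hznorm : Tendsto (fun z : ℂ => ‖z‖) l atTop := tendsto_norm_cobounded_atTop.mono_left hl
  have hinf : Tendsto (fun z => ‖μ z‖) l atTop := by
    have h1 : Tendsto (fun z => ‖κ z * (1 + c * (z⁻¹) ^ 2)‖ * ‖z‖ ^ 2) l atTop :=
      hrat.norm.pos_mul_atTop (norm_pos_iff.2 hκ₀) ((tendsto_pow_atTop two_ne_zero).comp hznorm)
    refine h1.congr' ?_
    filter_upwards [hμeq] with z hz
    rw [hz, norm_mul _ (z ^ 2), norm_pow]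
  have hμinv : (fun z => (μ z)⁻¹) =O[l] fun z => z⁻¹ := by
    have h1 : Tendsto (fun z => (κ z * (1 + c * (z⁻¹) ^ 2))⁻¹ * z⁻¹) l (𝓝 (κ₀⁻¹ * 0)) :=
      (hrat.inv₀ hκ₀).mul hinv
    have h2 := (h1.isBigO_one ℂ).mul (isBigO_refl (fun z : ℂ => z⁻¹) l)
    refine (h2.congr' ?_ (Eventually.of_forall fun z => one_mul _))
    filter_upwards [hμeq] with z hz
    rw [hz, mul_inv _ (z ^ 2), mul_assoc, sq z, mul_inv z]
  obtain ⟨CU, hCU0, hCU⟩ := exists_bound_Iic_of_tendsto_atBot hUc hp.fst.lim x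
  obtain ⟨CV, hCV0, hCV⟩ := exists_bound_Iic_of_tendsto_atBot hVc hp.snd.lim x
  obtain ⟨CN, hCN0, hCN⟩ := exists_bound_Iic_of_tendsto_atBot hNc hNlim x
  set k₁ : ℝ := ‖κ₀‖ + 1 with hk₁
  have hk₁0 : 0 ≤ k₁ := by positivity
  have hκle : ∀ᶠ z in l, ‖κ z‖ ≤ k₁ :=
    (hκlim.norm.eventually (gt_mem_nhds (lt_add_one _))).mono fun z hz => hz.le
  set e₀ : ℝ := Real.exp (2 * k₁ * CN) with he₀
  have he₀0 : 0 < e₀ := Real.exp_pos _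
  have hexp : ∀ {k : ℂ}, ‖k‖ ≤ k₁ → ∀ y ≤ x,
      ‖Complex.exp (2 * k * N y)‖ ≤ e₀ ∧ ‖Complex.exp (-(2 * k * N y))‖ ≤ e₀ :=
    fun {k} hk y hy => by
      have h1 : ‖2 * k * N y‖ ≤ 2 * k₁ * CN := by
        rw [norm_mul, norm_mul, Complex.norm_ofNat]
        have := hCN y hy
        gcongr
      exact ⟨(Complex.norm_exp_le_exp_norm _).trans (Real.exp_le_exp.2 h1),
        (Complex.norm_exp_le_exp_norm _).trans (Real.exp_le_exp.2 (by rwa [norm_neg]))⟩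
  set Q : ℝ → ℂ := fun y => c - U y * V y with hQdef
  -- One majorant for both α' and β, valid for every value of κ of norm at most `k₁`.
  set m : ℝ → ℝ := fun y =>
    k₁ * (‖deriv U y‖ + 2 * k₁ * ‖Q y‖ * CU) * e₀ + (‖deriv V y‖ + k₁ * CV * ‖Q y‖) * e₀ with hmdef
  have hQi := hp.integrableOn_defect x
  have hU'i : IntegrableOn (deriv U) (Set.Iic x) := hp.fst.deriv_int.integrableOn
  have hV'i : IntegrableOn (deriv V) (Set.Iic x) := hp.snd.deriv_int.integrableOn
  have hmi : IntegrableOn m (Set.Iic x) :=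
    (((hU'i.norm.add ((hQi.norm.const_mul (2 * k₁)).mul_const CU)).const_mul k₁).mul_const e₀).add
      ((hV'i.norm.add (hQi.norm.const_mul (k₁ * CV))).mul_const e₀)
  have hα'i : ∀ {k : ℂ}, ‖k‖ ≤ k₁ → IntegrableOn (fun y =>
      k * (deriv U y - 2 * k * Q y * U y) * Complex.exp (-(2 * k * N y))) (Set.Iic x) :=
    fun {k} hk => integrableOn_mul_of_bounded
      ((hU'i.sub (integrableOn_mul_of_bounded (hQi.const_mul (2 * k)) hUc hCU)).const_mul k)
      (by fun_prop) fun y hy => (hexp hk y hy).2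
  have hβi : ∀ {k : ℂ}, ‖k‖ ≤ k₁ → IntegrableOn (fun y =>
      (deriv V y + k * V y * Q y) * Complex.exp (2 * k * N y)) (Set.Iic x) :=
    fun {k} hk => by
      have h1 := (integrableOn_mul_of_bounded hQi hVc hCV).const_mul k
      refine integrableOn_mul_of_bounded (hV'i.add (h1.congr (Eventually.of_forall fun y => ?_)))
        (by fun_prop) fun y hy => (hexp hk y hy).1
      simp only; ring
  have hα'm : ∀ {k : ℂ}, ‖k‖ ≤ k₁ → ∀ y ≤ x,
      ‖k * (deriv U y - 2 * k * Q y * U y) * Complex.exp (-(2 * k * N y))‖ ≤ m y :=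
    fun {k} hk y hy => by
      have h1 := (hexp hk y hy).2
      have h2 := hCU y hy
      rw [norm_mul, norm_mul]
      refine le_add_of_le_of_nonneg ?_ (by positivity)
      gcongr
      refine (norm_sub_le _ _).trans ?_
      rw [norm_mul, norm_mul, norm_mul, Complex.norm_ofNat]
      gcongr
  have hβm : ∀ {k : ℂ}, ‖k‖ ≤ k₁ → ∀ y ≤ x,
      ‖(deriv V y + k * V y * Q y) * Complex.exp (2 * k * N y)‖ ≤ m y :=
    fun {k} hk y hy => by
      have h1 := (hexp hk y hy).1
      have h2 := hCV y hy
      rw [norm_mul]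
      refine le_add_of_nonneg_of_le (by positivity) ?_
      gcongr
      refine (norm_add_le _ _).trans ?_
      rw [norm_mul, norm_mul]
      gcongr
  have hsys : ∀ᶠ z in l, ∀ y, _ := (hw.and hne).mono fun z hz y =>
    hz.1.offDiagonal hz.2 hp.fst.diff hp.snd.diff hN (κ := κ z) rfl y
  have hw0lim : ∀ᶠ z in l, Tendsto (fun y => w z y 0) atBot (𝓝 1) ∧
      Tendsto (fun y => w z y 1) atBot (𝓝 (-V₀ / z)) := hw.mono fun z hz => by
    have := tendsto_pi_nhds.1 hz.lim
    exact ⟨by simpa using this 0, by simpa using this 1⟩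
  obtain ⟨hA, hB⟩ := offDiagonal_asymptotics (l := l) (X := x) (C := k₁ * CU * e₀) (m := m)
    (μ := μ) (α := fun z y => κ z * U y * Complex.exp (-(2 * κ z * N y)))
    (α' := fun z y => κ z * (deriv U y - 2 * κ z * Q y * U y) * Complex.exp (-(2 * κ z * N y)))
    (β := fun z y => (deriv V y + κ z * V y * Q y) * Complex.exp (2 * κ z * N y))
    (a := fun z y => Complex.exp (-(κ z * N y)) * w z y 0)
    (b := fun z y => Complex.exp (κ z * N y) * (z * w z y 1 + V y * w z y 0))
    (β₀ := fun y => (deriv V y + κ₀ * V y * Q y) * Complex.exp (2 * κ₀ * N y))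
    hμre hinf (hsys.mono fun z h y => (h y).1) (hsys.mono fun z h y => (h y).2.1)
    (hsys.mono fun z h y => (h y).2.2)
    (hw0lim.mono fun z h => by simpa using ((hNlim.const_mul (κ z)).neg.cexp).mul h.1)
    -- The limits cancel: z · (-V₀/z) + V₀ = 0.
    ((hw0lim.and hne).mono fun z h => by
      have := ((hNlim.const_mul (κ z)).cexp).mul
        ((h.1.2.const_mul z).add (hp.snd.lim.mul h.1.1))
      rw [mul_div_cancel₀ _ h.2] at this
      simpa using this)
    hmi (hκle.mono fun z h => hα'i h) (hκle.mono fun z h => hβi h)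
    (hκle.mono fun z h y hy => by
      have h1 := (hexp h y hy).2
      have h2 := hCU y hy
      rw [norm_mul, norm_mul]
      gcongr)
    (hκle.mono fun z h => hα'm h) (hκle.mono fun z h => hβm h)
    (hβi (by linarith)) (fun y _ => by
      exact (((hκlim.mul_const (V y)).mul_const (Q y)).const_add (deriv V y)).mul
        (((hκlim.const_mul 2).mul_const (N y)).cexp))
  have hexpO : (fun z => Complex.exp (κ z * N x) - Complex.exp (κ₀ * N x)) =O[l] fun z => z⁻¹ := by
    -- As a function of r = 1/z the exponential is differentiable at r = 0, which gives the O(1/z)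
    -- error.
    have hd : DifferentiableAt ℂ (fun r : ℂ => Complex.exp (κ₀ * (1 - c * r ^ 2) * N x)) 0 := by
      fun_prop
    have := hd.isBigO_sub.comp_tendsto hinv
    simp only [Function.comp_def, zero_pow two_ne_zero, mul_zero, sub_zero, mul_one] at this
    exact this
  have hexplim : Tendsto (fun z => Complex.exp (κ z * N x)) l (𝓝 (Complex.exp (κ₀ * N x))) :=
    (hκlim.mul_const (N x)).cexp
  have hP : (fun z => w z x 0 - Complex.exp (κ₀ * N x)) =O[l] fun z => z⁻¹ := by
    have h1 := ((hexplim.isBigO_one ℂ).mul (hA.trans hμinv)).congr_right fun z => one_mul _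
    refine (h1.add hexpO).congr_left fun z => ?_
    rw [mul_sub, ← mul_assoc, ← Complex.exp_add]
    simp
  have hG : Tendsto (fun z => z * w z x 1 + V x * w z x 0) l (𝓝 0) := by
    have h1 := ((hκlim.mul_const (N x)).neg.cexp).mul hB
    rw [mul_zero] at h1
    refine h1.congr fun z => ?_
    rw [← mul_assoc, ← Complex.exp_add]
    simp
  refine ⟨hP, ?_, hG⟩
  have hPlim : Tendsto (fun z => w z x 0) l (𝓝 (Complex.exp (κ₀ * N x))) :=
    tendsto_sub_nhds_zero_iff.1 (hP.trans_tendsto hinv)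
  have h1 : (fun z => (z * w z x 1 + V x * w z x 0) - V x * w z x 0) =O[l] fun _ => (1 : ℂ) :=
    (hG.isBigO_one ℂ).sub ((hPlim.const_mul (V x)).isBigO_one ℂ)
  refine (h1.mul (isBigO_refl (fun z : ℂ => z⁻¹) l)).congr' ?_
    (Eventually.of_forall fun z => one_mul _)
  filter_upwards [hne] with z hz
  field_simp
  ring

end Reduced

/-! ### Potentials seen from either end. -/

section Profiles

theorem IsProfile.conj {f : ℝ → ℂ} {f₀ : ℂ} (h : IsProfile f f₀) :
    IsProfile (fun x => (starRingEnd ℂ) (f x)) ((starRingEnd ℂ) f₀) where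
  diff := Complex.conjCLE.differentiable.comp h.diff
  deriv_int := by
    have : deriv (fun x => (starRingEnd ℂ) (f x)) = fun x => (starRingEnd ℂ) (deriv f x) :=
      funext fun x => (Complex.conjCLE.hasFDerivAt.comp_hasDerivAt x (h.diff x).hasDerivAt).deriv
    rw [this]
    exact Complex.conjCLE.toContinuousLinearMap.integrable_comp h.deriv_int
  lim := (Complex.continuous_conj.tendsto f₀).comp h.lim
  int x := by
    have := Complex.conjCLE.toContinuousLinearMap.integrable_comp (h.int x)
    simpa [IntegrableOn] using this

theorem integrableOn_Iic_of_continuous {f : ℝ → ℂ} (hf : Continuous f) {a : ℝ}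
    (h : IntegrableOn f (Set.Iic a)) (x : ℝ) : IntegrableOn f (Set.Iic x) :=
  (h.union (hf.integrableOn_Icc (a := a) (b := x))).mono_set fun y hy =>
    (le_total y a).imp id fun hya => ⟨hya, hy⟩

variable {u₀ : ℝ} {uInf : Side → ℂ} {u : ℝ → ℝ → ℂ}

/-- The orientation that carries an end to `-∞`. -/
def Side.sign : Side → ℝ
  | Side.minus => 1
  | Side.plus => -1

theorem Side.sign_mul_sign (s : Side) : s.sign * s.sign = 1 := by cases s <;> simp [Side.sign]

theorem Side.sign_mul_sign_mul (s : Side) (x : ℝ) : s.sign * (s.sign * x) = x := by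
  rw [← mul_assoc, s.sign_mul_sign, one_mul]

theorem Side.map_sign (s : Side) : map (fun x => s.sign * x) atBot = s.atEnd := by
  cases s
  · simp [Side.sign, Side.atEnd]
  · simp only [Side.sign, Side.atEnd, neg_one_mul]
    exact map_neg_atBot

/-- The sign of a column. -/
def colSign (j : Fin 2) : ℂ := if j = 0 then 1 else -1

/-- The potential as it enters the reduced system of a column. -/
def colPot (j : Fin 2) (v : ℂ) : ℂ := if j = 0 then v else (starRingEnd ℂ) v

theorem conj_colPot_mul (j : Fin 2) (v : ℂ) :
    colPot j v * (starRingEnd ℂ) (colPot j v) = (‖v‖ : ℂ) ^ 2 := by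
  fin_cases j
  · simp [colPot, Complex.mul_conj']
  · simp [colPot, Complex.conj_mul']

theorem isProfile_side (hdiff : ∀ t, Differentiable ℝ (fun x => u x t))
    (hlim : ∀ s t, Tendsto (fun x => u x t) (Side.atEnd s) (𝓝 (uInf s)))
    (hint : ∀ s t, IntegrableOn (fun x => u x t - uInf s) (Side.halfLine s))
    (hderiv : ∀ t, Integrable (deriv (fun x => u x t))) (s : Side) (t : ℝ) :
    IsProfile (fun x => u (s.sign * x) t) (uInf s) := by
  cases s with
  | minus =>
    simp only [Side.sign, one_mul]
    exact ⟨hdiff t, hderiv t, hlim .minus t, integrableOn_Iic_of_continuous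
      ((hdiff t).continuous.sub continuous_const) (hint .minus t)⟩
  | plus =>
    simp only [Side.sign, neg_one_mul]
    have hd : Differentiable ℝ fun x => u (-x) t := (hdiff t).comp differentiable_neg
    refine ⟨hd, ?_, (hlim .plus t).comp tendsto_neg_atBot_atTop,
      integrableOn_Iic_of_continuous (a := 0) (hd.continuous.sub continuous_const) ?_⟩
    · have : deriv (fun x => u (-x) t) = fun x => -deriv (fun x => u x t) (-x) :=
        funext fun x => deriv_comp_neg (fun x => u x t) x
      rw [this]
      exact (hderiv t).comp_neg.neg
    · have h : IntegrableOn (fun x => u x t - uInf .plus) (Set.Ici 0) := hint .plus t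
      have h' := h.mono_set Set.Ioi_subset_Ici_self
      rw [← neg_zero] at h'
      exact (integrableOn_Iic_iff_integrableOn_Iio (by simp)).2 h'.comp_neg_Iio

theorem isPotential_side (huInf : ∀ s, ‖uInf s‖ = u₀)
    (hdiff : ∀ t, Differentiable ℝ (fun x => u x t))
    (hlim : ∀ s t, Tendsto (fun x => u x t) (Side.atEnd s) (𝓝 (uInf s)))
    (hint : ∀ s t, IntegrableOn (fun x => u x t - uInf s) (Side.halfLine s))
    (hderiv : ∀ t, Integrable (deriv (fun x => u x t))) (s : Side) (j : Fin 2) (t : ℝ) :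
    IsPotential ((u₀ : ℂ) ^ 2) (fun x => colPot j (u (s.sign * x) t))
      (fun x => (starRingEnd ℂ) (colPot j (u (s.sign * x) t)))
      (colPot j (uInf s)) ((starRingEnd ℂ) (colPot j (uInf s))) := by
  have h := isProfile_side hdiff hlim hint hderiv s t
  have h1 : IsProfile (fun x => colPot j (u (s.sign * x) t)) (colPot j (uInf s)) := by
    fin_cases j
    · exact h
    · exact h.conj
  exact ⟨h1, h1.conj, by rw [conj_colPot_mul, huInf]⟩

theorem defect_eq (s : Side) (j : Fin 2) (t y : ℝ) :
    (u₀ : ℂ) ^ 2 - colPot j (u (s.sign * y) t) * (starRingEnd ℂ) (colPot j (u (s.sign * y) t))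
      = ((u₀ ^ 2 - ‖u (s.sign * y) t‖ ^ 2 : ℝ) : ℂ) := by
  rw [conj_colPot_mul]; push_cast; rfl

end Profiles

/-! ### Gauge transformations and reflections of linear systems. -/

section Conjugation

/-- A linear system after a constant linear substitution, multiplication by an exponential and a
reflection of the line. -/
theorem hasDerivAt_smul_mulVec_comp {A B : ℝ → Matrix (Fin 2) (Fin 2) ℂ}
    {T : Matrix (Fin 2) (Fin 2) ℂ} {ε : ℝ} {γ : ℂ} {e : ℝ → ℂ}
    (he : ∀ x, HasDerivAt e (γ * e x) x)
    (hB : ∀ x, (ε : ℂ) • (γ • T + T * A (ε * x)) = B x * T) {f : ℝ → Fin 2 → ℂ}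
    (hf : ∀ x, HasDerivAt f (A x *ᵥ f x) x) (x : ℝ) :
    HasDerivAt (fun x => e (ε * x) • (T *ᵥ f (ε * x)))
      (B x *ᵥ (e (ε * x) • (T *ᵥ f (ε * x)))) x := by
  have hT : HasDerivAt (fun y => T *ᵥ f y) (T *ᵥ (A (ε * x) *ᵥ f (ε * x))) (ε * x) :=
    ((LinearMap.toContinuousLinearMap (Matrix.toLin' T)).restrictScalars
      ℝ).hasFDerivAt.comp_hasDerivAt (ε * x) (hf (ε * x))
  have h1 := ((he (ε * x)).fun_smul hT).scomp x ((hasDerivAt_id x).const_mul ε)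
  refine h1.congr_deriv ?_
  rw [Matrix.mulVec_smul, Matrix.mulVec_mulVec _ (B x), ← hB x, Matrix.smul_mulVec,
    Matrix.add_mulVec, Matrix.smul_mulVec, Matrix.mulVec_mulVec, mul_one, ← Complex.coe_smul]
  module

/-- The substitution as a bijection between functions. -/
def substEquiv (T Ti : Matrix (Fin 2) (Fin 2) ℂ) (h1 : Ti * T = 1) (h2 : T * Ti = 1) (ε : ℝ)
    (hε : ε * ε = 1) (e : ℝ → ℂ) (he : ∀ x, e x ≠ 0) :
    (ℝ → Fin 2 → ℂ) ≃ (ℝ → Fin 2 → ℂ) where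
  toFun f x := e (ε * x) • (T *ᵥ f (ε * x))
  invFun w x := (e x)⁻¹ • (Ti *ᵥ w (ε * x))
  left_inv f := by
    funext x
    simp only [← mul_assoc, hε, one_mul, Matrix.mulVec_smul, smul_smul, inv_mul_cancel₀ (he x),
      one_smul, Matrix.mulVec_mulVec, h1, Matrix.one_mulVec]
  right_inv w := by
    funext x
    simp only [← mul_assoc, hε, one_mul, Matrix.mulVec_smul, smul_smul, mul_inv_cancel₀ (he _),
      one_smul, Matrix.mulVec_mulVec, h2, Matrix.one_mulVec]

/-- The inverse substitution has the same shape, with matrix `Ti` and the reciprocal exponential, so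
the converse is the forward statement applied to inverse data. -/
theorem substEquiv_solves_iff {T Ti : Matrix (Fin 2) (Fin 2) ℂ} {h1 : Ti * T = 1}
    {h2 : T * Ti = 1} {ε : ℝ} {hε : ε * ε = 1} {e : ℝ → ℂ} {he0 : ∀ x, e x ≠ 0}
    {A B : ℝ → Matrix (Fin 2) (Fin 2) ℂ} {γ : ℂ} (he : ∀ x, HasDerivAt e (γ * e x) x)
    (hB : ∀ x, (ε : ℂ) • (γ • T + T * A (ε * x)) = B x * T) (f : ℝ → Fin 2 → ℂ) :
    (∀ x, HasDerivAt f (A x *ᵥ f x) x) ↔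
      ∀ x, HasDerivAt (substEquiv T Ti h1 h2 ε hε e he0 f)
        (B x *ᵥ substEquiv T Ti h1 h2 ε hε e he0 f x) x := by
  refine ⟨fun hf => hasDerivAt_smul_mulVec_comp he hB hf, fun hw => ?_⟩
  set w := substEquiv T Ti h1 h2 ε hε e he0 f with hwdef
  have hεε : ∀ x, ε * (ε * x) = x := fun x => by rw [← mul_assoc, hε, one_mul]
  have hεC : (ε : ℂ) * ε = 1 := by exact_mod_cast hε
  have hf : f = fun x => (e (ε * (ε * x)))⁻¹ • (Ti *ᵥ w (ε * x)) := by
    simp only [hεε]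
    exact ((substEquiv T Ti h1 h2 ε hε e he0).symm_apply_apply f).symm
  have hd : ∀ x, HasDerivAt (fun y => (e (ε * y))⁻¹) (-(ε * γ) * (e (ε * x))⁻¹) x := fun x => by
    have := ((he (ε * x)).scomp x ((hasDerivAt_id x).const_mul ε)).inv (he0 (ε * x))
    refine this.congr_deriv ?_
    have := he0 (ε * x)
    simp only [mul_one, Complex.real_smul, Function.comp_apply]
    field_simp
  rw [hf]
  refine hasDerivAt_smul_mulVec_comp (ε := ε) (T := Ti) hd (A := B) (B := A) (fun x => ?_) hw
  have h3 := hB (ε * x)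
  rw [hεε] at h3
  have h4 : Ti * B (ε * x) = (ε : ℂ) • (γ • Ti + A x * Ti) := by
    calc Ti * B (ε * x) = Ti * (B (ε * x) * T) * Ti := by
          rw [mul_assoc, mul_assoc, h2, mul_one]
      _ = (ε : ℂ) • (γ • (Ti * T * Ti) + Ti * T * (A x * Ti)) := by
          rw [← h3]
          simp only [mul_add, add_mul, smul_mul_assoc, mul_smul_comm, mul_assoc]
      _ = _ := by rw [h1, one_mul, one_mul]
  have h5 : (ε : ℂ) * -(ε * γ) = -γ := by rw [mul_neg, ← mul_assoc, hεC, one_mul]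
  rw [h4, smul_add, smul_smul, smul_smul, smul_add, h5, hεC]
  module

end Conjugation

/-! ### Reduction of the four Jost columns. -/

section Columns

variable {α u₀ : ℝ} {uInf : Side → ℂ} {u : ℝ → ℝ → ℂ}

/-- The substitution matrix of a column. -/
def colMat (j : Fin 2) : Matrix (Fin 2) (Fin 2) ℂ := if j = 0 then 1 else !![0, 1; -1, 0]

/-- The inverse of `colMat`. -/
def colMatInv (j : Fin 2) : Matrix (Fin 2) (Fin 2) ℂ := if j = 0 then 1 else !![0, -1; 1, 0]

theorem colMatInv_mul (j : Fin 2) : colMatInv j * colMat j = 1 := by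
  fin_cases j
  · simp [colMat, colMatInv]
  · simp [colMat, colMatInv, Matrix.one_fin_two]

theorem colMat_mul (j : Fin 2) : colMat j * colMatInv j = 1 := by
  fin_cases j
  · simp [colMat, colMatInv]
  · simp [colMat, colMatInv, Matrix.one_fin_two]

theorem expISigma3_diag (a : ℂ) (j : Fin 2) :
    expISigma3 a j j = Complex.exp (colSign j * (Complex.I * a)) := by
  fin_cases j <;> simp [expISigma3, colSign]

theorem expISigma3_diag_ne_zero (a : ℂ) (j : Fin 2) : expISigma3 a j j ≠ 0 := by
  rw [expISigma3_diag]; exact Complex.exp_ne_zero _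

theorem hasDerivAt_expISigma3_phase (t : ℝ) (z : ℂ) (j : Fin 2) (x : ℝ) :
    HasDerivAt (fun x : ℝ => expISigma3 (-phase α u₀ x t z) j j)
      (colSign j * (Complex.I * (specK α u₀ z * specLam u₀ z))
        * expISigma3 (-phase α u₀ x t z) j j) x := by
  simp only [expISigma3_diag, phase, neg_neg]
  have h := ((((((hasDerivAt_id x).ofReal_comp).add_const
    ((2 * (α : ℂ) * specK α u₀ z ^ 2 - 4 * (α : ℂ) - (u₀ : ℂ) ^ 2 / (α : ℂ)) * (t : ℂ))).const_mul
    (specK α u₀ z * specLam u₀ z)).const_mul Complex.I).const_mul (colSign j)).cexp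
  refine h.congr_deriv ?_
  simp only [Complex.ofReal_one, mul_one, id]
  ring

/-- The coefficient `κ₀` of the reduced system of a column. -/
def rate (α : ℝ) (s : Side) (j : Fin 2) : ℂ :=
  (s.sign : ℂ) * colSign j * (Complex.I / (2 * α))

theorem rate_ne_zero (hα : 0 < α) (s : Side) (j : Fin 2) : rate α s j ≠ 0 := by
  have hα' : (α : ℂ) ≠ 0 := by exact_mod_cast hα.ne'
  have h1 : (s.sign : ℂ) ≠ 0 := by cases s <;> simp [Side.sign]
  have h2 : colSign j ≠ 0 := by fin_cases j <;> simp [colSign]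
  simp [rate, h1, h2, hα']

/-- The passage from a Jost column to the solution of its reduced system. -/
def colEquiv (α u₀ : ℝ) (s : Side) (j : Fin 2) (t : ℝ) (z : ℂ) :
    (ℝ → Fin 2 → ℂ) ≃ (ℝ → Fin 2 → ℂ) :=
  substEquiv (colMat j) (colMatInv j) (colMatInv_mul j) (colMat_mul j) s.sign s.sign_mul_sign
    (fun x => expISigma3 (-phase α u₀ x t z) j j) (fun _ => expISigma3_diag_ne_zero _ _)

/-- Since λ - αk = u₀²/z and λ + αk = z, adding ikλ to the diagonal entries ∓iαk² gives ik u₀²/z and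
ik z. For the second column the exchange of components produces the same form with -ik and the
conjugate potential. -/
theorem colMat_mul_laxX (hα : 0 < α) (s : Side) (j : Fin 2) {z : ℂ} (hz : z ≠ 0) (v : ℂ) :
    (s.sign : ℂ) • ((colSign j * (Complex.I * (specK α u₀ z * specLam u₀ z))) • colMat j
        + colMat j * laxX α u₀ v z)
      = ((rate α s j * (z - (u₀ : ℂ) ^ 2 / z)) • !![(u₀ : ℂ) ^ 2 / z, colPot j v;
          (starRingEnd ℂ) (colPot j v), z]) * colMat j := by
  have hα' : (α : ℂ) ≠ 0 := by exact_mod_cast hα.ne'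
  fin_cases j <;> ext a b <;> fin_cases a <;> fin_cases b <;>
    simp [colSign, colMat, colPot, laxX, sigma3, potQ, rate, specK, specLam, Matrix.mul_apply,
      Fin.sum_univ_two] <;> field_simp <;> ring

theorem colMat_mulVec_eigY (j : Fin 2) (v z : ℂ) :
    colMat j *ᵥ (eigY v z).col j = ![1, -(starRingEnd ℂ) (colPot j v) / z] := by
  fin_cases j <;> ext a <;> fin_cases a <;>
    simp [colMat, eigY, sigma3, potQ, colPot, Matrix.mulVec, dotProduct, Fin.sum_univ_two,
      Matrix.col, Matrix.one_apply, div_eq_inv_mul]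

theorem isJostColumn_iff (hα : 0 < α) (s : Side) (t : ℝ) {z : ℂ} (hz : z ≠ 0) (j : Fin 2)
    (f : ℝ → Fin 2 → ℂ) :
    IsJostColumn α u₀ uInf u s t z j f ↔
      IsReduced ((u₀ : ℂ) ^ 2) (rate α s j) (fun x => colPot j (u (s.sign * x) t))
        (fun x => (starRingEnd ℂ) (colPot j (u (s.sign * x) t)))
        ((starRingEnd ℂ) (colPot j (uInf s))) z (colEquiv α u₀ s j t z f) := by
  have h1 := substEquiv_solves_iff (h1 := colMatInv_mul j) (h2 := colMat_mul j)
    (hε := s.sign_mul_sign) (he0 := fun x => expISigma3_diag_ne_zero (-phase α u₀ x t z) j)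
    (hasDerivAt_expISigma3_phase t z j) (A := fun x => laxX α u₀ (u x t) z)
    (fun x => colMat_mul_laxX hα s j hz (u (s.sign * x) t)) f
  have h2 : Tendsto (fun x : ℝ => expISigma3 (-phase α u₀ x t z) j j • f x) s.atEnd
        (𝓝 ((eigY (uInf s) z).col j)) ↔
      Tendsto (colEquiv α u₀ s j t z f) atBot
        (𝓝 ![1, -(starRingEnd ℂ) (colPot j (uInf s)) / z]) := by
    rw [← s.map_sign, tendsto_map'_iff, ← colMat_mulVec_eigY]
    have hc : ∀ A : Matrix (Fin 2) (Fin 2) ℂ, Continuous fun v : Fin 2 → ℂ => A *ᵥ v := fun A =>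
      continuous_const.matrix_mulVec continuous_id
    constructor
    · intro h
      refine (((hc (colMat j)).tendsto _).comp h).congr fun x => ?_
      exact Matrix.mulVec_smul _ _ _
    · intro h
      have := ((hc (colMatInv j)).tendsto _).comp h
      rw [Matrix.mulVec_mulVec, colMatInv_mul, Matrix.one_mulVec] at this
      refine this.congr fun x => ?_
      change colMatInv j *ᵥ
        (expISigma3 (-phase α u₀ (s.sign * x) t z) j j • (colMat j *ᵥ f (s.sign * x))) = _
      rw [Matrix.mulVec_smul, Matrix.mulVec_mulVec, colMatInv_mul, Matrix.one_mulVec]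
      rfl
  simp only [Matrix.smul_mulVec] at h1
  exact ⟨fun h => ⟨h1.1 h.lax, h2.1 h.normalized⟩, fun h => ⟨h1.2 h.eq, h2.2 h.lim⟩⟩

/-- Writing c/z = r z̄ with r = c/|z|² turns the product into z² - r² z̄². -/
theorem im_sq_sub_div_sq (c : ℝ) {z : ℂ} (hz : z ≠ 0) :
    ((z - c / z) * (z + c / z)).im
      = 2 * (1 + c ^ 2 / Complex.normSq z ^ 2) * (z.re * z.im) := by
  have hn : (Complex.normSq z : ℂ) ≠ 0 := by exact_mod_cast (Complex.normSq_pos.2 hz).ne'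
  have h1 : (c : ℂ) / z = ((c / Complex.normSq z : ℝ) : ℂ) * (starRingEnd ℂ) z := by
    push_cast
    rw [← Complex.mul_conj] at hn ⊢
    have hz' : (starRingEnd ℂ) z ≠ 0 := right_ne_zero_of_mul hn
    field_simp
  rw [h1, ← div_pow]
  generalize c / Complex.normSq z = r
  simp
  ring

/-- The real part is minus (end sign) × (column sign) × Im((z - u₀²/z)(z + u₀²/z))/(2α), and that
imaginary part has the sign of Re z Im z. The choice of region for each column is made so that no
exponential grows. -/
theorem re_rate_nonpos (hα : 0 < α) {s : Side} {j : Fin 2} {z : ℂ} (hz : z ∈ jostDomain u₀ s j) :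
    (rate α s j * (z - (u₀ : ℂ) ^ 2 / z) * (z + (u₀ : ℂ) ^ 2 / z)).re ≤ 0 := by
  have hz0 : z ≠ 0 := by cases s <;> fin_cases j <;> exact hz.1
  have hsgn : (s.sign : ℂ) * colSign j = 1 ∧ 0 ≤ z.re * z.im ∨
      (s.sign : ℂ) * colSign j = -1 ∧ z.re * z.im ≤ 0 := by
    cases s <;> fin_cases j
    · exact .inl ⟨by simp [Side.sign, colSign], hz.2.2⟩
    · exact .inr ⟨by simp [Side.sign, colSign], hz.2.2⟩
    · exact .inr ⟨by simp [Side.sign, colSign], hz.2.2⟩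
    · exact .inl ⟨by simp [Side.sign, colSign], hz.2.2⟩
  have him := im_sq_sub_div_sq (u₀ ^ 2) hz0
  push_cast at him
  set W := (z - (u₀ : ℂ) ^ 2 / z) * (z + (u₀ : ℂ) ^ 2 / z) with hW
  have hI : (Complex.I / (2 * (α : ℂ)) * W).re = -(W.im / (2 * α)) := by
    have : Complex.I / (2 * (α : ℂ)) * W = ((1 / (2 * α) : ℝ) : ℂ) * (Complex.I * W) := by
      push_cast; ring
    rw [this, Complex.re_ofReal_mul]
    simp
    ring
  have hq : 0 ≤ 2 * (1 + (u₀ ^ 2) ^ 2 / Complex.normSq z ^ 2) := by positivity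
  rw [rate, mul_assoc, mul_assoc]
  rcases hsgn with ⟨h1, h2⟩ | ⟨h1, h2⟩
  · rw [h1, one_mul, hI, him, Left.neg_nonpos_iff]
    positivity
  · rw [h1, neg_one_mul, Complex.neg_re, hI, him, neg_neg]
    exact div_nonpos_of_nonpos_of_nonneg (mul_nonpos_of_nonneg_of_nonpos hq h2) (by positivity)

theorem ne_of_mem_jostDomain {s : Side} {j : Fin 2} {z : ℂ} (hz : z ∈ jostDomain u₀ s j) :
    z ≠ 0 ∧ z ^ 2 ≠ -(u₀ : ℂ) ^ 2 := by
  cases s <;> fin_cases j <;> exact ⟨hz.1, hz.2.1⟩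

end Columns

/-! ### Existence, uniqueness and expansion at infinity. -/

section Main

variable {α u₀ : ℝ} {uInf : Side → ℂ} {u : ℝ → ℝ → ℂ}

theorem existsUnique_isJostColumn (hα : 0 < α) (huInf : ∀ s, ‖uInf s‖ = u₀)
    (hdiff : ∀ t, Differentiable ℝ (fun x => u x t))
    (hlim : ∀ s t, Tendsto (fun x => u x t) (Side.atEnd s) (𝓝 (uInf s)))
    (hint : ∀ s t, IntegrableOn (fun x => u x t - uInf s) (Side.halfLine s))
    (hderiv : ∀ t, Integrable (deriv (fun x => u x t)))
    (s : Side) (j : Fin 2) (t : ℝ) {z : ℂ} (hz : z ∈ jostDomain u₀ s j) :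
    ∃! f : ℝ → Fin 2 → ℂ, IsJostColumn α u₀ uInf u s t z j f := by
  obtain ⟨hz0, hz2⟩ := ne_of_mem_jostDomain hz
  obtain ⟨w, hw, huniq⟩ := existsUnique_isReduced
    (isPotential_side huInf hdiff hlim hint hderiv s j t) hz0 hz2 (re_rate_nonpos hα hz)
  refine ⟨(colEquiv α u₀ s j t z).symm w, ?_, fun f hf => ?_⟩
  · refine (isJostColumn_iff hα s t hz0 j _).2 ?_
    rw [Equiv.apply_symm_apply]
    exact hw
  · rw [← huniq _ ((isJostColumn_iff hα s t hz0 j f).1 hf), Equiv.symm_apply_apply]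

theorem integrableOn_defect (huInf : ∀ s, ‖uInf s‖ = u₀)
    (hdiff : ∀ t, Differentiable ℝ (fun x => u x t))
    (hlim : ∀ s t, Tendsto (fun x => u x t) (Side.atEnd s) (𝓝 (uInf s)))
    (hint : ∀ s t, IntegrableOn (fun x => u x t - uInf s) (Side.halfLine s))
    (hderiv : ∀ t, Integrable (deriv (fun x => u x t))) (x t : ℝ) :
    IntegrableOn (fun y => u₀ ^ 2 - ‖u y t‖ ^ 2) (Set.Iic x) ∧
      IntegrableOn (fun y => u₀ ^ 2 - ‖u y t‖ ^ 2) (Set.Ici x) := by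
  have h : ∀ (s : Side) (x : ℝ), IntegrableOn (fun y => u₀ ^ 2 - ‖u (s.sign * y) t‖ ^ 2) (Set.Iic x) :=
    fun s x => by
      have h1 := (isPotential_side huInf hdiff hlim hint hderiv s 0 t).integrableOn_defect x
      simp only [defect_eq] at h1
      exact h1.re
  refine ⟨by simpa [Side.sign] using h .minus x, ?_⟩
  have h1 := (h .plus (-x)).mono_set Set.Iio_subset_Iic_self
  have h2 := h1.comp_neg_Ioi
  simp only [Side.sign, neg_one_mul, neg_neg] at h2
  exact (integrableOn_Ici_iff_integrableOn_Ioi (by simp)).2 h2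

/-- Identifies the exponent κ₀N of the reduced system with ±iν. At the right end the sign of the
reflection matches the reversed orientation of the integral from +∞. -/
theorem rate_mul_integral_defect (s : Side) (j : Fin 2) (x t : ℝ) :
    rate α s j * ∫ y in Set.Iic (s.sign * x), ((u₀ : ℂ) ^ 2 - colPot j (u (s.sign * y) t)
        * (starRingEnd ℂ) (colPot j (u (s.sign * y) t)))
      = colSign j * (Complex.I * (nu α u₀ u s x t : ℂ)) := by
  simp only [defect_eq]
  rw [integral_complex_ofReal]
  cases s with
  | minus =>
    simp only [Side.sign, one_mul, rate, nu]
    push_cast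
    ring
  | plus =>
    have h := integral_comp_neg_Iic (-x) (fun y => u₀ ^ 2 - ‖u y t‖ ^ 2)
    simp only [Side.sign, neg_one_mul, rate, nu]
    rw [h, neg_neg, integral_Ici_eq_integral_Ioi]
    push_cast
    ring

theorem modifiedJost_apply (φ : ℝ → ℝ → ℂ → Matrix (Fin 2) (Fin 2) ℂ) (x t : ℝ) (z : ℂ)
    (i j : Fin 2) :
    modifiedJost α u₀ φ x t z i j = φ x t z i j * expISigma3 (-phase α u₀ x t z) j j := by
  fin_cases j <;> simp [modifiedJost, expISigma3, Matrix.mul_apply, Fin.sum_univ_two]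

theorem colEquiv_apply_sign_mul (s : Side) (j : Fin 2) (φ : ℝ → ℝ → ℂ → Matrix (Fin 2) (Fin 2) ℂ)
    (x t : ℝ) (z : ℂ) :
    colEquiv α u₀ s j t z (fun x => (φ x t z).col j) (s.sign * x)
      = colMat j *ᵥ fun i => modifiedJost α u₀ φ x t z i j := by
  have : (fun i => modifiedJost α u₀ φ x t z i j)
      = expISigma3 (-phase α u₀ x t z) j j • (φ x t z).col j := by
    funext i
    rw [modifiedJost_apply, mul_comm]
    rfl
  rw [this, Matrix.mulVec_smul]
  simp only [colEquiv, substEquiv, Equiv.coe_fn_mk, Side.sign_mul_sign_mul]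

/-- Asymptotics of a column of the modified Jost solution as `z → ∞`. -/
theorem modifiedJost_asymptotics (hα : 0 < α) (huInf : ∀ s, ‖uInf s‖ = u₀)
    (hdiff : ∀ t, Differentiable ℝ (fun x => u x t))
    (hlim : ∀ s t, Tendsto (fun x => u x t) (Side.atEnd s) (𝓝 (uInf s)))
    (hint : ∀ s t, IntegrableOn (fun x => u x t - uInf s) (Side.halfLine s))
    (hderiv : ∀ t, Integrable (deriv (fun x => u x t)))
    {s : Side} {φ : ℝ → ℝ → ℂ → Matrix (Fin 2) (Fin 2) ℂ} (hφ : IsJost α u₀ uInf u s φ)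
    (x t : ℝ) :
    (∀ i j : Fin 2, (fun z : ℂ => modifiedJost α u₀ φ x t z i j
        - expISigma3 (nu α u₀ u s x t : ℂ) i j)
          =O[Bornology.cobounded ℂ ⊓ 𝓟 (jostDomain u₀ s j)] (fun z : ℂ => z⁻¹)) ∧
      Tendsto (fun z : ℂ => u x t * modifiedJost α u₀ φ x t z 1 1
          - z * modifiedJost α u₀ φ x t z 0 1)
        (Bornology.cobounded ℂ ⊓ 𝓟 (jostDomain u₀ s 1)) (𝓝 0) := by
  have hcg : (Bornology.cobounded ℂ).IsCountablyGenerated := by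
    rw [← comap_norm_atTop]; infer_instance
  have key := fun j : Fin 2 => IsReduced.asymptotics
    (l := Bornology.cobounded ℂ ⊓ 𝓟 (jostDomain u₀ s j)) inf_le_left
    (isPotential_side huInf hdiff hlim hint hderiv s j t) (rate_ne_zero hα s j)
    (w := fun z => colEquiv α u₀ s j t z (fun x => (φ x t z).col j))
    (by
      filter_upwards [mem_inf_of_right (mem_principal_self _)] with z hz
      exact (isJostColumn_iff hα s t (ne_of_mem_jostDomain hz).1 j _).1 (hφ j t z hz))
    (by
      filter_upwards [mem_inf_of_right (mem_principal_self _)] with z hz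
      exact re_rate_nonpos hα hz)
    (s.sign * x)
  simp only [colEquiv_apply_sign_mul, rate_mul_integral_defect, Side.sign_mul_sign_mul,
    ← expISigma3_diag] at key
  obtain ⟨h00, h10, -⟩ := key 0
  -- For the second column w = (φ₁₁, -φ₀₁), with entries numbered from 0, and V = u, so the third
  -- limit is the one used to recover u.
  obtain ⟨h11, h01, hu⟩ := key 1
  simp [colMat, colPot, Matrix.mulVec, dotProduct, Fin.sum_univ_two] at h00 h10 h11 h01 hu
  refine ⟨fun i j => ?_, ?_⟩
  · fin_cases i <;> fin_cases j
    · exact h00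
    · simpa [expISigma3] using h01
    · simpa [expISigma3] using h10
    · exact h11
  · refine hu.congr fun z => ?_
    ring

end Main

/-! ### The symmetry z ↦ -u₀²/z and the expansion at zero. -/

section Symmetry

variable {α u₀ : ℝ} {uInf : Side → ℂ} {u : ℝ → ℝ → ℂ}

/-- The other column. -/
def otherCol (j : Fin 2) : Fin 2 := if j = 0 then 1 else 0

/-- The factor relating a column of `Y_±` at `z` to the other column at `-u₀²/z`. -/
def symmFactor (j : Fin 2) (v z : ℂ) : ℂ := if j = 0 then -(starRingEnd ℂ) v / z else v / z

/-- The symmetry exchanges z and -u₀²/z, whose sum is proportional to k and whose difference is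
proportional to λ. Hence the spatial equation is unchanged while the phase changes sign. -/
theorem specK_symm (hu₀ : u₀ ≠ 0) {z : ℂ} (hz : z ≠ 0) :
    specK α u₀ (-(u₀ : ℂ) ^ 2 / z) = specK α u₀ z := by
  have : (u₀ : ℂ) ≠ 0 := by exact_mod_cast hu₀
  simp only [specK]
  congr 1
  field_simp
  ring

theorem specLam_symm (hu₀ : u₀ ≠ 0) {z : ℂ} (hz : z ≠ 0) :
    specLam u₀ (-(u₀ : ℂ) ^ 2 / z) = -specLam u₀ z := by
  have : (u₀ : ℂ) ≠ 0 := by exact_mod_cast hu₀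
  simp only [specLam]
  field_simp
  ring

theorem phase_symm (hu₀ : u₀ ≠ 0) {z : ℂ} (hz : z ≠ 0) (x t : ℝ) :
    phase α u₀ x t (-(u₀ : ℂ) ^ 2 / z) = -phase α u₀ x t z := by
  simp only [phase, specK_symm hu₀ hz, specLam_symm hu₀ hz]
  ring

theorem expISigma3_neg_otherCol (a : ℂ) (j : Fin 2) :
    expISigma3 (-a) (otherCol j) (otherCol j) = expISigma3 a j j := by
  fin_cases j <;> simp [expISigma3, otherCol]

theorem symmFactor_smul_eigY (hu₀ : u₀ ≠ 0) {v z : ℂ} (hv : ‖v‖ = u₀) (hz : z ≠ 0) (j : Fin 2) :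
    symmFactor j v z • (eigY v (-(u₀ : ℂ) ^ 2 / z)).col (otherCol j) = (eigY v z).col j := by
  have hv2 : v * (starRingEnd ℂ) v = (u₀ : ℂ) ^ 2 := by rw [Complex.mul_conj', hv]
  have hu : (u₀ : ℂ) ^ 2 ≠ 0 := by exact_mod_cast pow_ne_zero 2 hu₀
  have hv0 : v ≠ 0 := fun h => hu (by rw [← hv2, h, zero_mul])
  have hv0' : (starRingEnd ℂ) v ≠ 0 := fun h => hu (by rw [← hv2, h, mul_zero])
  rw [← hv2]
  fin_cases j <;> ext a <;> fin_cases a <;>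
    simp [symmFactor, otherCol, eigY, sigma3, potQ, Matrix.col] <;> field_simp

/-- The map reverses the sign of Re z Im z and has ±iu₀ as its fixed points, so it carries the
region of a column to that of the other column at the same end. -/
theorem symm_mem_jostDomain (hu₀ : u₀ ≠ 0) {s : Side} {j : Fin 2} {z : ℂ}
    (hz : z ∈ jostDomain u₀ s j) : -(u₀ : ℂ) ^ 2 / z ∈ jostDomain u₀ s (otherCol j) := by
  obtain ⟨h0, h2⟩ := ne_of_mem_jostDomain hz
  have hu : (u₀ : ℂ) ≠ 0 := by exact_mod_cast hu₀
  have h3 : -(u₀ : ℂ) ^ 2 / z ≠ 0 := div_ne_zero (neg_ne_zero.2 (pow_ne_zero 2 hu)) h0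
  have h4 : (-(u₀ : ℂ) ^ 2 / z) ^ 2 ≠ -(u₀ : ℂ) ^ 2 := fun h => h2 (by
    rw [div_pow, div_eq_iff (pow_ne_zero 2 h0)] at h
    have h5 : (u₀ : ℂ) ^ 2 * (z ^ 2 + (u₀ : ℂ) ^ 2) = 0 := by linear_combination h
    exact eq_neg_of_add_eq_zero_left ((mul_eq_zero.1 h5).resolve_left (pow_ne_zero 2 hu)))
  have h5 : (-(u₀ : ℂ) ^ 2 / z).re * (-(u₀ : ℂ) ^ 2 / z).im
      = -((u₀ ^ 2 / Complex.normSq z) ^ 2 * (z.re * z.im)) := by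
    have h6 : -(u₀ : ℂ) ^ 2 / z = ((-u₀ ^ 2 : ℝ) : ℂ) * z⁻¹ := by push_cast; ring
    rw [h6, Complex.re_ofReal_mul, Complex.im_ofReal_mul, Complex.inv_re, Complex.inv_im]
    ring
  have hq : 0 ≤ (u₀ ^ 2 / Complex.normSq z) ^ 2 := by positivity
  have hpos : 0 ≤ z.re * z.im → (-(u₀ : ℂ) ^ 2 / z).re * (-(u₀ : ℂ) ^ 2 / z).im ≤ 0 := fun h => by
    rw [h5]; exact neg_nonpos.2 (mul_nonneg hq h)
  have hneg : z.re * z.im ≤ 0 → 0 ≤ (-(u₀ : ℂ) ^ 2 / z).re * (-(u₀ : ℂ) ^ 2 / z).im := fun h => by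
    rw [h5]; exact neg_nonneg.2 (mul_nonpos_of_nonneg_of_nonpos hq h)
  cases s <;> fin_cases j
  · exact ⟨h3, h4, hpos hz.2.2⟩
  · exact ⟨h3, h4, hneg hz.2.2⟩
  · exact ⟨h3, h4, hneg hz.2.2⟩
  · exact ⟨h3, h4, hpos hz.2.2⟩

/-- The symmetry `z ↦ -u₀²/z` interchanges the Jost columns up to a factor. -/
theorem IsJostColumn.symm (hu₀ : u₀ ≠ 0) (huInf : ∀ s, ‖uInf s‖ = u₀) {s : Side} {t : ℝ} {z : ℂ}
    (hz : z ≠ 0) {j : Fin 2} {f : ℝ → Fin 2 → ℂ}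
    (hf : IsJostColumn α u₀ uInf u s t (-(u₀ : ℂ) ^ 2 / z) (otherCol j) f) :
    IsJostColumn α u₀ uInf u s t z j (fun x => symmFactor j (uInf s) z • f x) where
  lax x := by
    have h := (hf.lax x).const_smul (symmFactor j (uInf s) z)
    rw [laxX, specK_symm hu₀ hz, ← laxX, ← Matrix.mulVec_smul] at h
    exact h
  normalized := by
    have h := hf.normalized.const_smul (symmFactor j (uInf s) z)
    rw [symmFactor_smul_eigY hu₀ (huInf s) hz] at h
    refine h.congr fun x => ?_
    rw [phase_symm hu₀ hz, expISigma3_neg_otherCol, smul_comm]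

theorem modifiedJost_symm (hu₀ : u₀ ≠ 0) (huInf : ∀ s, ‖uInf s‖ = u₀) {s : Side} {j : Fin 2}
    {φ : ℝ → ℝ → ℂ → Matrix (Fin 2) (Fin 2) ℂ} (hφ : IsJost α u₀ uInf u s φ) {t : ℝ} {z : ℂ}
    (hz : z ∈ jostDomain u₀ s j)
    (huniq : ∃! f : ℝ → Fin 2 → ℂ, IsJostColumn α u₀ uInf u s t z j f) (x : ℝ) (i : Fin 2) :
    modifiedJost α u₀ φ x t z i j = symmFactor j (uInf s) z
      * modifiedJost α u₀ φ x t (-(u₀ : ℂ) ^ 2 / z) i (otherCol j) := by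
  have hz0 := (ne_of_mem_jostDomain hz).1
  have h := huniq.unique (hφ j t z hz)
    ((hφ (otherCol j) t _ (symm_mem_jostDomain hu₀ hz)).symm hu₀ huInf hz0)
  have h1 : φ x t z i j
      = symmFactor j (uInf s) z * φ x t (-(u₀ : ℂ) ^ 2 / z) i (otherCol j) :=
    congrFun (congrFun h x) i
  rw [modifiedJost_apply, modifiedJost_apply, h1, phase_symm hu₀ hz0, expISigma3_neg_otherCol,
    mul_assoc]

/-- The claimed leading term at 0 is the image of the leading term at ∞ under the symmetry, so the
two remainders correspond entry by entry. -/
theorem expISigma3_mul_sigma3_mul_potQ (a v z : ℂ) (i j : Fin 2) :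
    (z⁻¹ • (expISigma3 a * sigma3 * potQ v)) i j
      = symmFactor j v z * expISigma3 a i (otherCol j) := by
  fin_cases i <;> fin_cases j <;>
    simp [symmFactor, otherCol, expISigma3, sigma3, potQ] <;> ring

theorem tendsto_symm_cobounded (hu₀ : u₀ ≠ 0) (s : Side) (j : Fin 2) :
    Tendsto (fun z : ℂ => -(u₀ : ℂ) ^ 2 / z) (𝓝[≠] (0 : ℂ) ⊓ 𝓟 (jostDomain u₀ s j))
      (Bornology.cobounded ℂ ⊓ 𝓟 (jostDomain u₀ s (otherCol j))) := by
  have hu : -(u₀ : ℂ) ^ 2 ≠ 0 := neg_ne_zero.2 (pow_ne_zero 2 (by exact_mod_cast hu₀))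
  refine tendsto_inf.2 ⟨?_, ?_⟩
  · simp only [div_eq_mul_inv]
    exact ((tendsto_mul_left_cobounded hu).comp tendsto_inv₀_nhdsNE_zero).mono_left inf_le_left
  · refine tendsto_principal.2 ?_
    filter_upwards [mem_inf_of_right (mem_principal_self _)] with z hz
    exact symm_mem_jostDomain hu₀ hz

/-- Transfer of the asymptotics of the modified Jost solution from `∞` to `0`. -/
theorem modifiedJost_asymptotics_zero (hu₀ : u₀ ≠ 0) (huInf : ∀ s, ‖uInf s‖ = u₀) {s : Side}
    {j : Fin 2} {φ : ℝ → ℝ → ℂ → Matrix (Fin 2) (Fin 2) ℂ} (hφ : IsJost α u₀ uInf u s φ)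
    {t : ℝ} (huniq : ∀ z ∈ jostDomain u₀ s j,
      ∃! f : ℝ → Fin 2 → ℂ, IsJostColumn α u₀ uInf u s t z j f) {x : ℝ} {a : ℂ} {i : Fin 2}
    (h : (fun z : ℂ => modifiedJost α u₀ φ x t z i (otherCol j)
        - expISigma3 a i (otherCol j))
          =O[Bornology.cobounded ℂ ⊓ 𝓟 (jostDomain u₀ s (otherCol j))] (fun z : ℂ => z⁻¹)) :
    (fun z : ℂ => modifiedJost α u₀ φ x t z i j
        - (z⁻¹ • (expISigma3 a * sigma3 * potQ (uInf s))) i j)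
          =O[𝓝[≠] (0 : ℂ) ⊓ 𝓟 (jostDomain u₀ s j)] (fun _ : ℂ => (1 : ℂ)) := by
  have h1 := h.comp_tendsto (tendsto_symm_cobounded hu₀ s j)
  have hfac : (fun z => symmFactor j (uInf s) z)
      =O[𝓝[≠] (0 : ℂ) ⊓ 𝓟 (jostDomain u₀ s j)] fun z : ℂ => z⁻¹ := by
    fin_cases j <;> simp only [symmFactor, div_eq_mul_inv]
    · exact (isBigO_refl (fun z : ℂ => z⁻¹) _).const_mul_left _
    · exact (isBigO_refl (fun z : ℂ => z⁻¹) _).const_mul_left _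
  have h2 := hfac.mul h1
  -- At the image point the remainder O(1/z) becomes O(z), which cancels the 1/z of the symmetry
  -- factor.
  have h3 : (fun z : ℂ => z⁻¹ * ((fun z : ℂ => z⁻¹) ∘ fun z => -(u₀ : ℂ) ^ 2 / z) z)
      =O[𝓝[≠] (0 : ℂ) ⊓ 𝓟 (jostDomain u₀ s j)] fun _ : ℂ => (1 : ℂ) := by
    refine ((isBigO_refl (fun _ : ℂ => (1 : ℂ)) _).const_mul_left
      ((-(u₀ : ℂ) ^ 2)⁻¹)).congr' ?_ EventuallyEq.rfl
    filter_upwards [mem_inf_of_right (mem_principal_self _)] with z hz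
    have := (ne_of_mem_jostDomain hz).1
    simp only [Function.comp_apply]
    field_simp
  refine (h2.trans h3).congr' ?_ EventuallyEq.rfl
  filter_upwards [mem_inf_of_right (mem_principal_self _)] with z hz
  rw [modifiedJost_symm hu₀ huInf hφ hz (huniq z hz), expISigma3_mul_sigma3_mul_potQ]
  simp only [Function.comp_apply]
  ring

end Symmetry

/-! ### Recovery of the potential. -/

section Recovery

variable {α u₀ : ℝ} {u : ℝ → ℝ → ℂ}

/-- Recovery of the potential from the asymptotics of the second column. -/
theorem tendsto_recovery {l : Filter ℂ} (hl : l ≤ Bornology.cobounded ℂ)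
    {W : ℂ → Matrix (Fin 2) (Fin 2) ℂ} {a v : ℂ}
    (h1 : (fun z => W z 1 1 - expISigma3 a 1 1) =O[l] fun z => z⁻¹)
    (h0 : Tendsto (fun z => v * W z 1 1 - z * W z 0 1) l (𝓝 0)) :
    Tendsto (fun z : ℂ => (expISigma3 a * (z • W z)) 0 1) l (𝓝 v) := by
  have h2 : Tendsto (fun z => W z 1 1) l (𝓝 (expISigma3 a 1 1)) :=
    tendsto_sub_nhds_zero_iff.1 (h1.trans_tendsto (tendsto_inv_of_le_cobounded hl).1)
  have h3 := ((h2.const_mul v).sub h0).const_mul (expISigma3 a 0 0)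
  -- The two diagonal entries are reciprocal, so the phase e^{iν} disappears from the limit.
  have h4 : expISigma3 a 0 0 * (v * expISigma3 a 1 1 - 0) = v := by
    simp only [expISigma3, Matrix.of_apply, Matrix.cons_val', Matrix.cons_val_zero,
      Matrix.cons_val_one, Matrix.cons_val_fin_one, sub_zero]
    rw [mul_left_comm, ← Complex.exp_add, add_neg_cancel, Complex.exp_zero, mul_one]
  rw [h4] at h3
  refine h3.congr fun z => ?_
  simp [expISigma3, Matrix.mul_apply, Fin.sum_univ_two]

end Recovery

end MNLS

end

theorem mainTheorem5 (α u₀ : ℝ) (hα : 0 < α) (hu₀ : 0 < u₀)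
    (uInf : MNLS.Side → ℂ) (huInf : ∀ s, ‖uInf s‖ = u₀)
    (u : ℝ → ℝ → ℂ)
    (hdiff : ∀ t, Differentiable ℝ (fun x => u x t))
    (hlim : ∀ s t, Tendsto (fun x => u x t) (MNLS.Side.atEnd s) (𝓝 (uInf s)))
    (hint : ∀ s t, IntegrableOn (fun x => u x t - uInf s) (MNLS.Side.halfLine s))
    (hderiv : ∀ t, Integrable (deriv (fun x => u x t))) :
    -- the Jost solutions exist and are unique, column by column
    (∀ (s : MNLS.Side) (j : Fin 2) (t : ℝ), ∀ z ∈ MNLS.jostDomain u₀ s j,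
      ∃! f : ℝ → Fin 2 → ℂ, MNLS.IsJostColumn α u₀ uInf u s t z j f) ∧
    -- the integrals in `ν_±` converge
    (∀ x t : ℝ, IntegrableOn (fun y => u₀ ^ 2 - ‖u y t‖ ^ 2) (Set.Iic x) ∧
      IntegrableOn (fun y => u₀ ^ 2 - ‖u y t‖ ^ 2) (Set.Ici x)) ∧
    ∀ (s : MNLS.Side) (φ : ℝ → ℝ → ℂ → Matrix (Fin 2) (Fin 2) ℂ),
      MNLS.IsJost α u₀ uInf u s φ → ∀ x t : ℝ,
      -- `z → ∞`, entry by entry, in the region of the column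
      (∀ i j : Fin 2,
        (fun z : ℂ => MNLS.modifiedJost α u₀ φ x t z i j
            - MNLS.expISigma3 (MNLS.nu α u₀ u s x t : ℂ) i j)
          =O[Bornology.cobounded ℂ ⊓ 𝓟 (MNLS.jostDomain u₀ s j)] (fun z : ℂ => z⁻¹)) ∧
      -- `z → 0`, entry by entry, in the region of the column
      (∀ i j : Fin 2,
        (fun z : ℂ => MNLS.modifiedJost α u₀ φ x t z i j
            - (z⁻¹ • (MNLS.expISigma3 (MNLS.nu α u₀ u s x t : ℂ)
                * MNLS.sigma3 * MNLS.potQ (uInf s))) i j)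
          =O[𝓝[≠] (0 : ℂ) ⊓ 𝓟 (MNLS.jostDomain u₀ s j)] (fun _ : ℂ => (1 : ℂ))) ∧
      -- recovery of the potential
      Tendsto (fun z : ℂ => (MNLS.expISigma3 (MNLS.nu α u₀ u s x t : ℂ)
          * (z • MNLS.modifiedJost α u₀ φ x t z)) 0 1)
        (Bornology.cobounded ℂ ⊓ 𝓟 (MNLS.jostDomain u₀ s 1)) (𝓝 (u x t)) := by
  have hex := fun s j t z (hz : z ∈ MNLS.jostDomain u₀ s j) =>
    MNLS.existsUnique_isJostColumn hα huInf hdiff hlim hint hderiv s j t hz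
  refine ⟨hex, fun x t => MNLS.integrableOn_defect huInf hdiff hlim hint hderiv x t,
    fun s φ hφ x t => ?_⟩
  obtain ⟨hinf, hrec⟩ :=
    MNLS.modifiedJost_asymptotics hα huInf hdiff hlim hint hderiv hφ x t
  exact ⟨hinf, fun i j => MNLS.modifiedJost_asymptotics_zero hu₀.ne' huInf hφ (hex s j t)
    (hinf i (MNLS.otherCol j)), MNLS.tendsto_recovery inf_le_left (hinf 1 1) hrec⟩
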